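/- Let $F$ be the free pro-$3$ group on two generators $x, y$, and let $\sigma : F \to F$ be the continuous automorphism with $\sigma(x) = x^{-1}$ and $\sigma(y) = y^{-1}$. For $n \ge 1$ put $r_n = x^3 y^{-3^n}$ and $t = y x y x^{-1} y$, and let $$G_n = \langle x, y \mid r_n^{-1}\sigma(r_n),\ t^{-1}\sigma(t) \rangle$$ be the pro-$3$ group with this presentation, i.e. the quotient of $F$ by the closed normal subgroup generated by $r_n^{-1}\sigma(r_n)$ and $t^{-1}\sigma(t)$. Then for every $n \ge 1$: (i) $G_n$ is a finite $3$-group of order $3^{3n+2}$; (ii) $G_n$ is nilpotent of class $2n+1$; (iii) $G_n$ is solvable of derived length $\lfloor \log_2(3n+3) \rfloor$. In particular, the derived lengths of the groups $G_n$, $n \ge 1$, are unbounded. -/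

import Mathlib

/-- The normal subgroups of `G` whose index is a power of `p`. -/
structure PNormal (p : ℕ) (G : Type) [Group G] : Type where
  /-- The underlying subgroup. -/
  sub : Subgroup G
  normal : sub.Normal
  index_eq : ∃ k : ℕ, sub.index = p ^ k

namespace PNormal

variable {p : ℕ} {G : Type} [Group G]

instance (N : PNormal p G) : N.sub.Normal := N.normal

/-- The finite quotient `G / N`. -/
abbrev Quot (N : PNormal p G) : Type := G ⧸ N.sub

/-- Finite quotients carry the discrete topology. -/
instance (N : PNormal p G) : TopologicalSpace N.Quot := ⊥

instance (N : PNormal p G) : DiscreteTopology N.Quot := ⟨rfl⟩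

/-- The projection `G / N → G / M` for `N ≤ M`. -/
def proj (N M : PNormal p G) (h : N.sub ≤ M.sub) : N.Quot →* M.Quot :=
  QuotientGroup.map N.sub M.sub (MonoidHom.id G) h

/-- The preimage of a normal subgroup of `p`-power index. -/
def comap [Fact p.Prime] {H : Type} [Group H] (φ : G →* H) (N : PNormal p H) : PNormal p G :=
  ⟨N.sub.comap φ, inferInstance, by
    obtain ⟨k, hk⟩ := N.index_eq
    have h : (N.sub.comap φ).index ∣ p ^ k := by
      rw [Subgroup.index_comap, ← hk]
      exact Subgroup.relIndex_dvd_index_of_normal _ _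
    obtain ⟨j, -, hj⟩ := (Nat.dvd_prime_pow Fact.out).1 h
    exact ⟨j, hj⟩⟩

end PNormal

/-- The pro-`p` completion of `G`: the inverse limit of the quotients of `G` by its normal
subgroups of `p`-power index, as a subgroup of their product. It carries the topology induced by
the product topology. -/
def proPCompletion (p : ℕ) (G : Type) [Group G] :
    Subgroup (∀ N : PNormal p G, N.Quot) where
  carrier := {f | ∀ (N M : PNormal p G) (h : N.sub ≤ M.sub), N.proj M h (f N) = f M}
  one_mem' := fun N M h => map_one (N.proj M h)
  mul_mem' := fun {f g} hf hg N M h => by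
    rw [Pi.mul_apply, Pi.mul_apply, map_mul, hf N M h, hg N M h]
  inv_mem' := fun {f} hf N M h => by
    rw [Pi.inv_apply, Pi.inv_apply, map_inv, hf N M h]

namespace proPCompletion

variable {p : ℕ} {G : Type} [Group G]

/-- The canonical homomorphism from `G` to its pro-`p` completion. -/
def of (p : ℕ) {G : Type} [Group G] : G →* proPCompletion p G where
  toFun g := ⟨fun _ => QuotientGroup.mk g, fun _ _ _ => rfl⟩
  map_one' := rfl
  map_mul' _ _ := rfl

/-- The continuous homomorphism of pro-`p` completions induced by `φ : G →* H`. -/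
def map [Fact p.Prime] {H : Type} [Group H] (φ : G →* H) :
    proPCompletion p G →ₜ* proPCompletion p H where
  toFun f := ⟨fun N => QuotientGroup.map (N.comap φ).sub N.sub φ le_rfl (f.1 (N.comap φ)), by
    intro N M h
    have hc : (N.comap φ).sub ≤ (M.comap φ).sub := Subgroup.comap_mono h
    have hf := f.2 (N.comap φ) (M.comap φ) hc
    change _ = QuotientGroup.map (M.comap φ).sub M.sub φ le_rfl (f.1 (M.comap φ))
    rw [← hf]
    change N.proj M h (QuotientGroup.map (N.comap φ).sub N.sub φ le_rfl (f.1 (N.comap φ))) = _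
    generalize f.1 (N.comap φ) = q
    induction q using QuotientGroup.induction_on
    rfl⟩
  map_one' := Subtype.ext (funext fun _ => map_one _)
  map_mul' _ _ := Subtype.ext (funext fun _ => map_mul _ _ _)
  continuous_toFun := by
    refine Continuous.subtype_mk (continuous_pi fun N => ?_) _
    exact (continuous_of_discreteTopology (α := (N.comap φ).Quot)).comp
      ((continuous_apply (N.comap φ)).comp continuous_subtype_val)

theorem map_of [Fact p.Prime] {H : Type} [Group H] (φ : G →* H) (g : G) :
    map (p := p) φ (of p g) = of p (φ g) := rfl

theorem map_map [Fact p.Prime] (φ ψ : G →* G) (h : φ.comp ψ = MonoidHom.id G)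
    (f : proPCompletion p G) : map φ (map ψ f) = f := by
  apply Subtype.ext
  funext N
  have hle : ((N.comap φ).comap ψ).sub ≤ N.sub := fun g hg => by
    have hg' : φ (ψ g) ∈ N.sub := hg
    rwa [← MonoidHom.comp_apply, h] at hg'
  have hf := f.2 ((N.comap φ).comap ψ) N hle
  rw [← hf]
  change QuotientGroup.map _ _ φ _ (QuotientGroup.map _ _ ψ _ (f.1 ((N.comap φ).comap ψ))) = _
  generalize f.1 ((N.comap φ).comap ψ) = q
  induction q using QuotientGroup.induction_on with
  | H g => exact congrArg (fun a : G => (QuotientGroup.mk a : N.Quot)) (DFunLike.congr_fun h g)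

end proPCompletion

/-- The smallest closed normal subgroup containing `S`. -/
def closedNormalClosure {F : Type} [Group F] [TopologicalSpace F] [IsTopologicalGroup F]
    (S : Set F) : Subgroup F :=
  (Subgroup.normalClosure S).topologicalClosure

instance {F : Type} [Group F] [TopologicalSpace F] [IsTopologicalGroup F] (S : Set F) :
    (closedNormalClosure S).Normal :=
  Subgroup.is_normal_topologicalClosure _

/-- The free pro-`3` group on two generators. -/
abbrev FreePro3 : Type := proPCompletion 3 (FreeGroup (Fin 2))

namespace FreePro3

/-- The first generator. -/
def x : FreePro3 := proPCompletion.of 3 (FreeGroup.of 0)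

/-- The second generator. -/
def y : FreePro3 := proPCompletion.of 3 (FreeGroup.of 1)

/-- The endomorphism of the abstract free group inverting both generators. -/
def invGens : FreeGroup (Fin 2) →* FreeGroup (Fin 2) :=
  FreeGroup.lift fun i => (FreeGroup.of i)⁻¹

theorem invGens_comp : invGens.comp invGens = MonoidHom.id (FreeGroup (Fin 2)) := by
  ext i
  simp [invGens]

/-- The continuous automorphism of the free pro-`3` group inverting both generators. -/
def σ : FreePro3 ≃ₜ* FreePro3 where
  toFun := proPCompletion.map invGens
  invFun := proPCompletion.map invGens
  left_inv := proPCompletion.map_map _ _ invGens_comp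
  right_inv := proPCompletion.map_map _ _ invGens_comp
  map_mul' := map_mul _
  continuous_toFun := (proPCompletion.map invGens).continuous_toFun
  continuous_invFun := (proPCompletion.map invGens).continuous_toFun

theorem σ_x : σ x = x⁻¹ := by
  change proPCompletion.map invGens (proPCompletion.of 3 (FreeGroup.of 0)) = _
  rw [proPCompletion.map_of, invGens, FreeGroup.lift_apply_of, map_inv]
  rfl

theorem σ_y : σ y = y⁻¹ := by
  change proPCompletion.map invGens (proPCompletion.of 3 (FreeGroup.of 1)) = _
  rw [proPCompletion.map_of, invGens, FreeGroup.lift_apply_of, map_inv]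
  rfl

/-- The element `r_n = x³ y^(-3ⁿ)`. -/
def r (n : ℕ) : FreePro3 := x ^ 3 * y ^ (-(3 : ℤ) ^ n)

/-- The element `t = y x y x⁻¹ y`. -/
def t : FreePro3 := y * x * y * x⁻¹ * y

end FreePro3

open FreePro3 in
/-- The group with pro-`3` presentation `⟨x, y | r_n⁻¹ σ(r_n), t⁻¹ σ(t)⟩`. -/
abbrev GroupG (n : ℕ) : Type :=
  FreePro3 ⧸ closedNormalClosure {(r n)⁻¹ * σ (r n), t⁻¹ * σ t}

/-- `G` is solvable of derived length `d`: `d` is the least index at which the derived series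
of `G` is trivial. -/
def HasDerivedLength (G : Type) [Group G] (d : ℕ) : Prop :=
  IsLeast {k : ℕ | derivedSeries G k = ⊥} d

/-! The order of a finite `3`-quotient satisfying the relations is bounded above by commutator
calculus, and a matrix group attains the bound.

Upper bound. Squaring is injective in a finite `3`-group, so the first relator forces `x³ = y^(3ⁿ)`,
and `x³` commutes with `y`. Write `γ_i` for the lower central series, `d = [y, x]`, `e = [d, x]`, `g
= [d, y]`. Expanding `[y, x³] = 1` gives `[e, x] ≡ d⁻³` modulo `γ_5`, and the second relator gives
`y³ ≡ e` modulo `γ_4`. With the Jacobi identity these yield `[g, y] ≡ d³` and `[e, y] ≡ [g, x] ≡ 1`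
modulo `γ_5`. Cubing sends `γ_i` into `γ_(i+2)` for `i ≥ 2`, so by induction `d^(3^k)` generates
`γ_(2k+2)` modulo the next term, and `e^(3^k)`, `g^(3^k)` generate `γ_(2k+3)` (`SchurRel.gens_even`,
`SchurRel.gens_odd`). These layers have order at most `3` and `9`. Since `x³ = y^(3ⁿ) ≡ e^(3^(n-1))`
commutes with `x`, the layer of `d^(3ⁿ)` collapses and `γ_(2n+2) = 1` (`SchurRel.lcs_eq_bot`). Hence
the order is at most `9 · 27ⁿ`.

Lower bound. Over `(ℤ/3^(n+1))[√3]` two explicit `2 × 2` matrices satisfy the second relation, and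
the congruence filtration of the group they generate has layers of at least the required sizes
(`card_ge_of_hom`). There the cube of the first matrix is `1`, which need not equal the `3ⁿ`-th
power of the second; a factor `ℤ/9` and a central quotient repair this (`exists_large_pNormal`).

Both bounds agree, so a largest finite quotient exists, and it is the whole pro-`3` quotient
(`closedNormalClosure_eq_ker`). Equality of orders makes `γ_(2n+1)` nontrivial, which fixes the
class. The commutators `[d, e]`, `[d, g]`, `[e, g]` show that each derived subgroup is a term `γ_i`,
with `i` going to `2i` or `2i + 1` according to parity (`SchurRel.derivedSeries_eq`). -/

/-- The lower central series, indexed so that `lcs G 1` is the whole group. -/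
def lcs (G : Type*) [Group G] (i : ℕ) : Subgroup G := (⊤ : Subgroup G).lowerCentralSeries (i - 1)

/-- The commutator `a⁻¹ b⁻¹ a b`. -/
def com {G : Type*} [Group G] (a b : G) : G := a⁻¹ * b⁻¹ * a * b

/-! ### Commutator calculus modulo the lower central series. -/

section LowerCentral

open scoped commutatorElement

variable {G : Type*} [Group G]

instance (i : ℕ) : (lcs G i).Normal := by unfold lcs; infer_instance

theorem lcs_one : lcs G 1 = ⊤ := rfl

theorem mem_lcs_one (a : G) : a ∈ lcs G 1 := Subgroup.mem_top a

theorem lcs_succ {i : ℕ} (hi : 1 ≤ i) : lcs G (i + 1) = ⁅lcs G i, ⊤⁆ := by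
  obtain ⟨j, rfl⟩ := Nat.exists_eq_add_of_le' hi
  rfl

theorem lcs_anti {i j : ℕ} (h : i ≤ j) : lcs G j ≤ lcs G i :=
  Subgroup.lowerCentralSeries_antitone _ (by omega)

/-- The three subgroups lemma, applied in `G ⧸ N`. -/
theorem commutator_commutator_le_of_rotate (H₁ H₂ H₃ N : Subgroup G) [N.Normal]
    (h1 : ⁅⁅H₂, H₃⁆, H₁⁆ ≤ N) (h2 : ⁅⁅H₃, H₁⁆, H₂⁆ ≤ N) : ⁅⁅H₁, H₂⁆, H₃⁆ ≤ N := by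
  have key : ∀ K : Subgroup G, K ≤ N ↔ K.map (QuotientGroup.mk' N) = ⊥ := fun K => by
    rw [Subgroup.map_eq_bot_iff, QuotientGroup.ker_mk']
  rw [key, Subgroup.map_commutator, Subgroup.map_commutator] at *
  exact Subgroup.commutator_commutator_eq_bot_of_rotate h1 h2

theorem commutator_lcs_le (i j : ℕ) : ⁅lcs G i, lcs G j⁆ ≤ lcs G (i + j) := by
  induction j generalizing i with
  | zero => exact Subgroup.commutator_le_left _ _
  | succ j ih =>
    rcases Nat.eq_zero_or_pos j with rfl | hj
    · rcases Nat.eq_zero_or_pos i with rfl | hi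
      · exact le_top
      · exact (lcs_succ hi).ge
    · rcases Nat.eq_zero_or_pos i with rfl | hi
      · rw [Nat.zero_add]; exact Subgroup.commutator_le_right _ _
      rw [Subgroup.commutator_comm, lcs_succ hj]
      apply commutator_commutator_le_of_rotate
      · rw [Subgroup.commutator_comm ⊤, ← lcs_succ hi]
        exact (ih (i + 1)).trans (lcs_anti (by omega))
      · have := Subgroup.commutator_mono (ih i) (le_refl (⊤ : Subgroup G))
        rwa [← lcs_succ (by omega)] at this

theorem com_eq (a b : G) : com a b = ⁅a⁻¹, b⁻¹⁆ := by
  simp [com, commutatorElement_def]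

theorem com_mem {i j k : ℕ} (h : k ≤ i + j) {a b : G} (ha : a ∈ lcs G i) (hb : b ∈ lcs G j) :
    com a b ∈ lcs G k := by
  rw [com_eq]
  exact lcs_anti h (commutator_lcs_le i j
    (Subgroup.commutator_mem_commutator (inv_mem ha) (inv_mem hb)))

theorem com_swap (a b : G) : com b a = (com a b)⁻¹ := by simp [com, mul_assoc]

theorem com_self (a : G) : com a a = 1 := by simp [com]

theorem com_mul_left (a b c : G) : com (a * b) c = com a c * com (com a c) b * com b c := by
  simp [com, mul_assoc]

theorem com_mul_right (a b c : G) : com a (b * c) = com a c * com a b * com (com a b) c := by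
  simp [com, mul_assoc]

theorem mul_com (a b : G) : a * b = b * a * com a b := by simp [com, mul_assoc]

/-- With `d = com a b`, `e = com d a`, `f = com e a` the right side is the word `d e e f (d e) d` of
`lcsEq_collect`; `mul_cube` produces the same word with `d = b`. -/
theorem com_cube (a b : G) : com (a ^ 3) b =
    com a b * com (com a b) a * com (com a b) a * com (com (com a b) a) a *
      (com a b * com (com a b) a) * com a b := by
  simp [com, pow_succ, mul_assoc]

theorem com_cube_right (a b : G) : com a (b ^ 3) =
    com a b * (com a b * com (com a b) b) *
      (com a b * com (com a b) b * com (com a b) b * com (com (com a b) b) b) := by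
  simp [com, pow_succ, mul_assoc]

theorem mul_cube (a b : G) : (a * b) ^ 3 =
    a ^ 3 * (b * com b a * com b a * com (com b a) a * (b * com b a) * b) := by
  simp [com, pow_succ, mul_assoc]

theorem hall_witt (a b c : G) : com (com a b) (a⁻¹ * c * a) * com (com c a) (c⁻¹ * b * c) *
    com (com b c) (b⁻¹ * a * b) = 1 := by
  simp [com, mul_assoc]

/-- Equality modulo a term of the lower central series. -/
def LcsEq (k : ℕ) (a b : G) : Prop := (QuotientGroup.mk a : G ⧸ lcs G k) = QuotientGroup.mk b

namespace LcsEq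

variable {k : ℕ} {a b c a' b' : G}

theorem refl (k : ℕ) (a : G) : LcsEq k a a := rfl

theorem of_eq (k : ℕ) (h : a = b) : LcsEq k a b := h ▸ rfl

theorem symm (h : LcsEq k a b) : LcsEq k b a := Eq.symm h

theorem trans (h : LcsEq k a b) (h' : LcsEq k b c) : LcsEq k a c := Eq.trans h h'

theorem mul (h : LcsEq k a b) (h' : LcsEq k a' b') : LcsEq k (a * a') (b * b') := by
  unfold LcsEq at *; rw [QuotientGroup.mk_mul, QuotientGroup.mk_mul, h, h']

theorem inv (h : LcsEq k a b) : LcsEq k a⁻¹ b⁻¹ := by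
  unfold LcsEq at *; rw [QuotientGroup.mk_inv, QuotientGroup.mk_inv, h]

theorem iff_mem : LcsEq k a b ↔ a⁻¹ * b ∈ lcs G k := QuotientGroup.eq

theorem one_iff : LcsEq k a 1 ↔ a ∈ lcs G k := QuotientGroup.eq_one_iff a

theorem mono {k' : ℕ} (hk : k ≤ k') (h : LcsEq k' a b) : LcsEq k a b :=
  iff_mem.2 (lcs_anti hk (iff_mem.1 h))

theorem mem (h : LcsEq k a b) (hb : b ∈ lcs G k) : a ∈ lcs G k :=
  one_iff.1 (h.trans (one_iff.2 hb))

theorem mem_of_le {j : ℕ} (h : LcsEq k a b) (hj : j ≤ k) (hb : b ∈ lcs G j) : a ∈ lcs G j :=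
  (h.mono hj).mem hb

theorem commute {i j : ℕ} (hk : k ≤ i + j) (ha : a ∈ lcs G i) (hb : b ∈ lcs G j) :
    LcsEq k (a * b) (b * a) := by
  rw [mul_com]
  simpa using (refl k (b * a)).mul (one_iff.2 (com_mem hk ha hb))

theorem com_left {i j : ℕ} (hk : k ≤ i + j) (h : LcsEq i a a') (hb : b ∈ lcs G j) :
    LcsEq k (_root_.com a b) (_root_.com a' b) := by
  have hu := iff_mem.1 h
  obtain ⟨u, rfl⟩ : ∃ u, a' = a * u := ⟨a⁻¹ * a', by group⟩
  rw [inv_mul_cancel_left] at hu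
  rw [com_mul_left]
  have h1 : _root_.com (_root_.com a b) u ∈ lcs G k :=
    com_mem (i := j) (by omega) (com_mem (i := 0) (by omega) (Subgroup.mem_top a) hb) hu
  have := ((refl k (_root_.com a b)).mul (one_iff.2 h1)).mul (one_iff.2 (com_mem hk hu hb))
  simpa using this.symm

theorem com_right {i j : ℕ} (hk : k ≤ i + j) (h : LcsEq i a a') (hb : b ∈ lcs G j) :
    LcsEq k (_root_.com b a) (_root_.com b a') := by
  rw [com_swap a b, com_swap a' b]
  exact (com_left hk h hb).inv

theorem mul_left {i i' j : ℕ} (hk : k ≤ i + i' + j) (ha : a ∈ lcs G i) (ha' : a' ∈ lcs G i')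
    (hb : b ∈ lcs G j) :
    LcsEq k (_root_.com (a * a') b) (_root_.com a b * _root_.com a' b) := by
  rw [com_mul_left]
  have h1 : _root_.com (_root_.com a b) a' ∈ lcs G k :=
    com_mem (i := i + j) (by omega) (com_mem le_rfl ha hb) ha'
  simpa using ((refl k (_root_.com a b)).mul (one_iff.2 h1)).mul (refl k (_root_.com a' b))

theorem mul_right {i j j' : ℕ} (hk : k ≤ i + j + j') (ha : a ∈ lcs G i) (hb : b ∈ lcs G j)
    (hb' : b' ∈ lcs G j') :
    LcsEq k (_root_.com a (b * b')) (_root_.com a b' * _root_.com a b) := by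
  rw [com_mul_right]
  have h1 : _root_.com (_root_.com a b) b' ∈ lcs G k :=
    com_mem (i := i + j) (by omega) (com_mem le_rfl ha hb) hb'
  simpa using (refl k (_root_.com a b' * _root_.com a b)).mul (one_iff.2 h1)

theorem inv_left {i j : ℕ} (hk : k ≤ i + i + j) (ha : a ∈ lcs G i) (hb : b ∈ lcs G j) :
    LcsEq k (_root_.com a⁻¹ b) (_root_.com a b)⁻¹ := by
  have h := mul_left hk ha (inv_mem ha) hb
  rw [mul_inv_cancel] at h
  have h1 : _root_.com 1 b = 1 := by simp [_root_.com]
  rw [h1] at h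
  simpa using ((refl k (_root_.com a b)⁻¹).mul h).symm

/-- The Jacobi identity. -/
theorem jacobi {i j l : ℕ} (hi : 1 ≤ i) (hj : 1 ≤ j) (hl : 1 ≤ l) (hk : k ≤ i + j + l + 1)
    (ha : a ∈ lcs G i) (hb : b ∈ lcs G j) (hc : c ∈ lcs G l) :
    LcsEq k (_root_.com (_root_.com a b) c * _root_.com (_root_.com c a) b *
      _root_.com (_root_.com b c) a) 1 := by
  -- The conjugates in the Hall–Witt identity differ from the plain elements only one term further
  -- down; this is why the congruence holds modulo degree `i + j + l + 1` and no further.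
  have conj : ∀ {p q : ℕ} {u v : G}, 1 ≤ q → u ∈ lcs G p → v ∈ lcs G q →
      LcsEq (p + 1) u (v⁻¹ * u * v) := fun {p q u v} hq hu hv => by
    have : v⁻¹ * u * v = u * _root_.com u v := by simp [_root_.com, mul_assoc]
    rw [this]
    simpa using (refl (p + 1) u).mul (one_iff.2 (com_mem (by omega) hu hv)).symm
  have h := of_eq k (hall_witt a b c)
  refine (((com_right ?_ (conj hi hc ha) (com_mem le_rfl ha hb)).mul
    (com_right ?_ (conj hl hb hc) (com_mem le_rfl hc ha))).mul
    (com_right ?_ (conj hj ha hb) (com_mem le_rfl hb hc))).trans h <;> omega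

end LcsEq

theorem mul_comm_collect {H : Type*} [Group H] {d e f : H} (hd : e * d = d * e) (hf : f = 1) :
    d * e * e * f * (d * e) * d = d ^ 3 * e ^ 3 := by
  have h' : ∀ z, e * (d * z) = d * (e * z) := fun z => by rw [← mul_assoc, hd, mul_assoc]
  subst hf
  simp [pow_succ, mul_assoc, hd, h']

theorem lcsEq_collect {i j k l : ℕ} {d e f : G} (hk : k ≤ i + j) (hl : k ≤ l) (hd : d ∈ lcs G i)
    (he : e ∈ lcs G j) (hf : f ∈ lcs G l) :
    LcsEq k (d * e * e * f * (d * e) * d) (d ^ 3 * e ^ 3) :=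
  mul_comm_collect (H := G ⧸ lcs G k) (d := d) (e := e) (f := f)
    (LcsEq.commute (k := k) (by omega) he hd)
    (LcsEq.one_iff.2 (lcs_anti hl hf))

/-- Commutators of elements of `lcs G i` and `lcs G j` lie in `P` as
soon as those of generators modulo the next terms do. -/
theorem com_mem_of_gen {i j : ℕ} (hi : 1 ≤ i) (hj : 1 ≤ j) {S T : Set G} {P : Subgroup G}
    (hS : S ⊆ lcs G i) (hT : T ⊆ lcs G j)
    (hSgen : lcs G i ≤ Subgroup.closure S ⊔ lcs G (i + 1))
    (hTgen : lcs G j ≤ Subgroup.closure T ⊔ lcs G (j + 1)) (hP : lcs G (i + j + 1) ≤ P)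
    (h : ∀ s ∈ S, ∀ t ∈ T, com s t ∈ P) {a b : G} (ha : a ∈ lcs G i) (hb : b ∈ lcs G j) :
    com a b ∈ P := by
  have cong : ∀ {u v : G}, LcsEq (i + j + 1) u v → v ∈ P → u ∈ P := fun {u v} huv hv => by
    have := hP (LcsEq.iff_mem.1 huv.symm)
    simpa using mul_mem hv this
  -- Modulo `lcs G (i + j + 1)` the commutator is multiplicative in each argument, so the good
  -- elements form a subgroup; it then suffices to test generators, one argument at a time.
  have left : ∀ t ∈ lcs G j, (∀ s ∈ S, com s t ∈ P) → ∀ a ∈ lcs G i, com a t ∈ P := by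
    intro t ht hst a ha
    let A : Subgroup G :=
      { carrier := {a | a ∈ lcs G i ∧ com a t ∈ P}
        one_mem' := ⟨one_mem _, by simp [com]⟩
        mul_mem' := fun {a b} ha hb => ⟨mul_mem ha.1 hb.1,
          cong (LcsEq.mul_left (by omega) ha.1 hb.1 ht) (mul_mem ha.2 hb.2)⟩
        inv_mem' := fun {a} ha => ⟨inv_mem ha.1,
          cong (LcsEq.inv_left (by omega) ha.1 ht) (inv_mem ha.2)⟩ }
    have hA : Subgroup.closure S ⊔ lcs G (i + 1) ≤ A := by
      refine sup_le ((Subgroup.closure_le _).2 fun s hs => ⟨hS hs, hst s hs⟩) fun s hs => ?_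
      exact ⟨lcs_anti (by omega) hs, hP (com_mem (by omega) hs ht)⟩
    exact (hA (hSgen ha)).2
  let A : Subgroup G :=
    { carrier := {b | b ∈ lcs G j ∧ com a b ∈ P}
      one_mem' := ⟨one_mem _, by simp [com]⟩
      mul_mem' := fun {b c} hb hc => ⟨mul_mem hb.1 hc.1,
        cong (LcsEq.mul_right (by omega) ha hb.1 hc.1) (mul_mem hc.2 hb.2)⟩
      inv_mem' := fun {b} hb => ⟨inv_mem hb.1, by
        rw [com_swap, ← inv_mem_iff (H := P), inv_inv]
        refine cong (LcsEq.inv_left (by omega) hb.1 ha) ?_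
        rw [com_swap, inv_inv]
        exact hb.2⟩ }
  have hA : Subgroup.closure T ⊔ lcs G (j + 1) ≤ A := by
    refine sup_le ((Subgroup.closure_le _).2 fun t ht => ⟨hT ht, ?_⟩) fun s hs => ?_
    · exact left t (hT ht) (fun s hs => h s hs t ht) a ha
    · exact ⟨lcs_anti (by omega) hs, hP (com_mem (by omega) ha hs)⟩
  exact (hA (hTgen hb)).2

theorem lcs_succ_le {i : ℕ} (hi : 1 ≤ i) {P : Subgroup G}
    (h : ∀ a ∈ lcs G i, ∀ b : G, com a b ∈ P) : lcs G (i + 1) ≤ P := by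
  rw [lcs_succ hi, Subgroup.commutator_le]
  intro a ha b _
  have := h a⁻¹ (inv_mem ha) b⁻¹
  rwa [com_eq, inv_inv, inv_inv] at this

/-- A normal subgroup covering `lcs G m` modulo the next term contains it if `G` is nilpotent. -/
theorem lcs_le_of_le_sup [Group.IsNilpotent G] {m : ℕ} (hm : 1 ≤ m) {K : Subgroup G} [K.Normal]
    (h : lcs G m ≤ K ⊔ lcs G (m + 1)) : lcs G m ≤ K := by
  have step : ∀ j, lcs G (m + j) ≤ K ⊔ lcs G (m + j + 1) := by
    intro j
    induction j with
    | zero => exact h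
    | succ j ih =>
      rw [← add_assoc, lcs_succ (i := m + j) (by omega), Subgroup.commutator_le]
      intro a ha b _
      have hb := ih ha
      rw [Subgroup.mem_sup_of_normal_left] at hb
      obtain ⟨u, hu, v, hv, rfl⟩ := hb
      rw [commutatorElement_mul_left_eq_conj_mul]
      refine mul_mem (SetLike.le_def.1 le_sup_right ?_) (SetLike.le_def.1 le_sup_left ?_)
      · refine Subgroup.Normal.conj_mem inferInstance _ ?_ _
        have := Subgroup.commutator_mem_commutator hv (Subgroup.mem_top b)
        rwa [← lcs_succ (by omega)] at this
      · exact Subgroup.commutator_le_left K ⊤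
          (Subgroup.commutator_mem_commutator hu (Subgroup.mem_top b))
  have all : ∀ j, lcs G m ≤ K ⊔ lcs G (m + j) := by
    intro j
    induction j with
    | zero => exact le_sup_right
    | succ j ih => exact ih.trans (sup_le le_sup_left (step j))
  obtain ⟨c, hc⟩ := Subgroup.nilpotent_iff_lowerCentralSeries.1 (inferInstance : Group.IsNilpotent G)
  have hbot : lcs G (m + (c + 1)) = ⊥ := by
    rw [eq_bot_iff, ← hc]
    exact Subgroup.lowerCentralSeries_antitone _ (by omega)
  simpa [hbot] using all (c + 1)

end LowerCentral

/-! ### Cubing and the lower central series. -/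

section Cubing

variable {G : Type*} [Group G]

/-- `S` generates `lcs G i` modulo the next term. -/
def Gens (i : ℕ) (S : Set G) : Prop :=
  S ⊆ lcs G i ∧ lcs G i ≤ Subgroup.closure S ⊔ lcs G (i + 1)

/-- Cubes of elements of `lcs G m` lie in the next term. -/
def CubeSucc (G : Type*) [Group G] : Prop := ∀ m, 1 ≤ m → ∀ a ∈ lcs G m, a ^ 3 ∈ lcs G (m + 1)

/-- Cubes of elements of `lcs G m` lie two terms below, for `2 ≤ m`. -/
def CubeSuccSucc (G : Type*) [Group G] : Prop :=
  ∀ m, 2 ≤ m → ∀ a ∈ lcs G m, a ^ 3 ∈ lcs G (m + 2)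

theorem mul_cube_lcsEq_weak {m : ℕ} {a b : G} (ha : a ∈ lcs G m) (hb : b ∈ lcs G m) :
    LcsEq (m + m) ((a * b) ^ 3) (a ^ 3 * b ^ 3) :=
  (show Commute (a : G ⧸ lcs G (m + m)) b from LcsEq.commute le_rfl ha hb).mul_pow 3

theorem com_cube_lcsEq_weak {i j : ℕ} {a b : G} (ha : a ∈ lcs G i) (hb : b ∈ lcs G j) :
    LcsEq (i + i + j) (com (a ^ 3) b) (com a b ^ 3) := by
  have hd : com a b ∈ lcs G (i + j) := com_mem le_rfl ha hb
  have he : com (com a b) a ∈ lcs G (i + i + j) := com_mem (by omega) hd ha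
  have hf : com (com (com a b) a) a ∈ lcs G (i + i + j) := com_mem (Nat.le_add_right _ i) he ha
  rw [com_cube]
  have := (((((LcsEq.refl (i + i + j) (com a b)).mul (LcsEq.one_iff.2 he)).mul
    (LcsEq.one_iff.2 he)).mul (LcsEq.one_iff.2 hf)).mul
    ((LcsEq.refl (i + i + j) (com a b)).mul (LcsEq.one_iff.2 he))).mul
    (LcsEq.refl (i + i + j) (com a b))
  simpa [pow_succ] using this

/-- Cubing is multiplicative on each layer, and `[a, b]³ ≡ [a³, b]` carries the property from one
layer to the next. -/
theorem cubeSucc_of_gens {S : Set G} (hS : Gens 1 S) (h : ∀ s ∈ S, s ^ 3 ∈ lcs G 2) :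
    CubeSucc G := by
  intro m hm
  induction m, hm using Nat.le_induction with
  | base =>
    let A : Subgroup G :=
      { carrier := {a | a ^ 3 ∈ lcs G 2}
        one_mem' := by simp
        mul_mem' := fun {a b} ha hb =>
          (mul_cube_lcsEq_weak (mem_lcs_one a) (mem_lcs_one b)).mem (mul_mem ha hb)
        inv_mem' := fun {a} ha => by
          change a⁻¹ ^ 3 ∈ lcs G 2
          rw [inv_pow]; exact inv_mem ha }
    have hA : lcs G 1 ≤ A := hS.2.trans (sup_le ((Subgroup.closure_le _).2 h)
      fun a ha => pow_mem ha 3)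
    exact fun a ha => hA ha
  | succ m hm ih =>
    let A : Subgroup G :=
      { carrier := {a | a ∈ lcs G (m + 1) ∧ a ^ 3 ∈ lcs G (m + 1 + 1)}
        one_mem' := ⟨one_mem _, by simp⟩
        mul_mem' := fun {a b} ha hb => ⟨mul_mem ha.1 hb.1,
          ((mul_cube_lcsEq_weak ha.1 hb.1).mono (by omega)).mem (mul_mem ha.2 hb.2)⟩
        inv_mem' := fun {a} ha => ⟨inv_mem ha.1, by rw [inv_pow]; exact inv_mem ha.2⟩ }
    have hA : lcs G (m + 1) ≤ A := lcs_succ_le hm fun a ha b =>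
      ⟨com_mem le_rfl ha (mem_lcs_one b),
        ((com_cube_lcsEq_weak ha (mem_lcs_one b)).symm.mono (by omega)).mem
          (com_mem le_rfl (ih a ha) (mem_lcs_one b))⟩
    exact fun a ha => (hA ha).2

/-- In the collected word `[b, a]` occurs as a cube, so `CubeSucc` pushes it into degree `2m + 1`,
which is at least `m + 3` exactly when `m ≥ 2`. -/
theorem mul_cube_lcsEq (hw : CubeSucc G) {m : ℕ} (hm : 2 ≤ m) {a b : G} (ha : a ∈ lcs G m)
    (hb : b ∈ lcs G m) : LcsEq (m + 3) ((a * b) ^ 3) (a ^ 3 * b ^ 3) := by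
  have he : com b a ∈ lcs G (m + m) := com_mem le_rfl hb ha
  have hf : com (com b a) a ∈ lcs G (m + m + m) := com_mem le_rfl he ha
  rw [mul_cube]
  refine (LcsEq.refl _ _).mul ((lcsEq_collect (by omega) (by omega) hb he hf).trans ?_)
  simpa using (LcsEq.refl (m + 3) (b ^ 3)).mul
    (LcsEq.one_iff.2 (lcs_anti (by omega) (hw (m + m) (by omega) _ he)))

theorem com_cube_lcsEq (hw : CubeSucc G) {i j k : ℕ} (hi : 2 ≤ i) (hk : k ≤ i + j + 3) {a b : G}
    (ha : a ∈ lcs G i) (hb : b ∈ lcs G j) : LcsEq k (com (a ^ 3) b) (com a b ^ 3) := by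
  have hd : com a b ∈ lcs G (i + j) := com_mem le_rfl ha hb
  have he : com (com a b) a ∈ lcs G (i + i + j) := com_mem (by omega) hd ha
  have hf : com (com (com a b) a) a ∈ lcs G (i + i + i + j) := com_mem (by omega) he ha
  rw [com_cube]
  refine (lcsEq_collect (by omega) (by omega) hd he hf).trans ?_
  simpa using (LcsEq.refl k (com a b ^ 3)).mul
    (LcsEq.one_iff.2 (lcs_anti (by omega) (hw (i + i + j) (by omega) _ he)))

/-- The induction of `cubeSucc_of_gens` with the sharper `mul_cube_lcsEq` and `com_cube_lcsEq`,
whose error terms are already controlled by the weak form `hw`. -/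
theorem cubeSuccSucc_of_gens (hw : CubeSucc G) {S : Set G} (hS : Gens 2 S)
    (h : ∀ s ∈ S, s ^ 3 ∈ lcs G 4) : CubeSuccSucc G := by
  intro m hm
  induction m, hm using Nat.le_induction with
  | base =>
    let A : Subgroup G :=
      { carrier := {a | a ∈ lcs G 2 ∧ a ^ 3 ∈ lcs G 4}
        one_mem' := ⟨one_mem _, by simp⟩
        mul_mem' := fun {a b} ha hb => ⟨mul_mem ha.1 hb.1,
          (mul_cube_lcsEq_weak ha.1 hb.1).mem (mul_mem ha.2 hb.2)⟩
        inv_mem' := fun {a} ha => ⟨inv_mem ha.1, by rw [inv_pow]; exact inv_mem ha.2⟩ }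
    have hA : lcs G 2 ≤ A := hS.2.trans (sup_le
      ((Subgroup.closure_le _).2 fun s hs => ⟨hS.1 hs, h s hs⟩)
      fun a ha => ⟨lcs_anti (by omega) ha, hw 3 (by omega) a ha⟩)
    exact fun a ha => (hA ha).2
  | succ m hm ih =>
    let A : Subgroup G :=
      { carrier := {a | a ∈ lcs G (m + 1) ∧ a ^ 3 ∈ lcs G (m + 1 + 2)}
        one_mem' := ⟨one_mem _, by simp⟩
        mul_mem' := fun {a b} ha hb => ⟨mul_mem ha.1 hb.1,
          ((mul_cube_lcsEq_weak ha.1 hb.1).mono (by omega)).mem (mul_mem ha.2 hb.2)⟩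
        inv_mem' := fun {a} ha => ⟨inv_mem ha.1, by rw [inv_pow]; exact inv_mem ha.2⟩ }
    have hA : lcs G (m + 1) ≤ A := lcs_succ_le (by omega) fun a ha b =>
      ⟨com_mem le_rfl ha (mem_lcs_one b),
        (com_cube_lcsEq hw hm (by omega) ha (mem_lcs_one b)).symm.mem
          (com_mem (by omega) (ih a ha) (mem_lcs_one b))⟩
    exact fun a ha => (hA ha).2

theorem cube_congr (hw : CubeSucc G) (hs : CubeSuccSucc G) {m : ℕ} (hm : 2 ≤ m) {a b : G}
    (ha : a ∈ lcs G m) (h : LcsEq (m + 1) a b) : LcsEq (m + 3) (a ^ 3) (b ^ 3) := by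
  have hu := LcsEq.iff_mem.1 h
  obtain ⟨u, rfl⟩ : ∃ u, b = a * u := ⟨a⁻¹ * b, by group⟩
  rw [inv_mul_cancel_left] at hu
  have h1 := mul_cube_lcsEq hw hm ha (lcs_anti (by omega) hu)
  have h2 := (LcsEq.refl (m + 3) (a ^ 3)).mul
    (LcsEq.one_iff.2 (hs (m + 1) (by omega) u hu))
  rw [mul_one] at h2
  exact (h1.trans h2).symm

theorem pow_mem_lcs (hs : CubeSuccSucc G) {m : ℕ} (hm : 2 ≤ m) {a : G} (ha : a ∈ lcs G m) (k : ℕ) :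
    a ^ 3 ^ k ∈ lcs G (m + 2 * k) := by
  induction k with
  | zero => simpa using ha
  | succ k ih =>
    rw [pow_succ, pow_mul]
    exact hs (m + 2 * k) (by omega) _ ih

theorem pow_congr (hw : CubeSucc G) (hs : CubeSuccSucc G) {m : ℕ} (hm : 2 ≤ m) {a b : G}
    (ha : a ∈ lcs G m) (h : LcsEq (m + 1) a b) (k : ℕ) :
    LcsEq (m + 1 + 2 * k) (a ^ 3 ^ k) (b ^ 3 ^ k) := by
  induction k with
  | zero => simpa using h
  | succ k ih =>
    rw [pow_succ, pow_mul, pow_mul]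
    exact (cube_congr hw hs (m := m + 2 * k) (by omega) (pow_mem_lcs hs hm ha k)
      (ih.mono (by omega))).mono (by omega)

theorem com_pow_lcsEq (hw : CubeSucc G) (hs : CubeSuccSucc G) {i j : ℕ} (hi : 2 ≤ i) {a b : G}
    (ha : a ∈ lcs G i) (hb : b ∈ lcs G j) (k : ℕ) :
    LcsEq (i + j + 1 + 2 * k) (com (a ^ 3 ^ k) b) (com a b ^ 3 ^ k) := by
  induction k with
  | zero => simpa using LcsEq.refl _ _
  | succ k ih =>
    rw [pow_succ, pow_mul, pow_mul]
    have hm := pow_mem_lcs hs hi ha k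
    refine (com_cube_lcsEq hw (i := i + 2 * k) (j := j) (by omega) (by omega) hm hb).trans ?_
    exact (cube_congr hw hs (m := i + 2 * k + j) (by omega) (com_mem le_rfl hm hb)
      (ih.mono (by omega))).mono (by omega)

end Cubing

/-! ### Consequences of the relations in low degree. -/

section Relations

variable {G : Type*} [Group G]

/-- The relations satisfied by the generators of the groups `GroupG n` and their quotients. -/
structure SchurRel (x y : G) : Prop where
  gen : Subgroup.closure {x, y} = ⊤
  com_x_cube : com y (x ^ 3) = 1
  x_cube : x ^ 3 ∈ lcs G 2
  y_cube : y ^ 3 ∈ lcs G 2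
  rel : y * x * y * x⁻¹ * y = y⁻¹ * x⁻¹ * y⁻¹ * x * y⁻¹

theorem collect_three {H : Type*} [Group H] {d e f : H} (h1 : e * d = d * e) (h2 : f * d = d * f)
    (h3 : f * e = e * f) : d * e * e * f * (d * e) * d = d ^ 3 * e ^ 3 * f := by
  have h1' : ∀ z, e * (d * z) = d * (e * z) := fun z => by rw [← mul_assoc, h1, mul_assoc]
  have h2' : ∀ z, f * (d * z) = d * (f * z) := fun z => by rw [← mul_assoc, h2, mul_assoc]
  have h3' : ∀ z, f * (e * z) = e * (f * z) := fun z => by rw [← mul_assoc, h3, mul_assoc]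
  simp [pow_succ, mul_assoc, h1', h2, h2', h3]

theorem collect_three' {H : Type*} [Group H] {d e f : H} (h1 : e * d = d * e) :
    d * (d * e) * (d * e * e * f) = d ^ 3 * e ^ 3 * f := by
  have h1' : ∀ z, e * (d * z) = d * (e * z) := fun z => by rw [← mul_assoc, h1, mul_assoc]
  simp [pow_succ, mul_assoc, h1']

namespace SchurRel

variable {x y : G} (h : SchurRel x y)
include h

theorem gens_one : Gens 1 ({x, y} : Set G) :=
  ⟨fun a _ => mem_lcs_one a, by rw [h.gen]; exact le_sup_of_le_left le_top⟩

theorem cubeSucc : CubeSucc G :=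
  cubeSucc_of_gens h.gens_one (by
    rintro s (rfl | rfl)
    exacts [h.x_cube, h.y_cube])

end SchurRel

/-- In names below, `d = [y, x]`, `e = [d, x]` and `g = [d, y]`. -/
theorem d_mem (x y : G) : com y x ∈ lcs G 2 := com_mem le_rfl (mem_lcs_one y) (mem_lcs_one x)

theorem e_mem (x y : G) : com (com y x) x ∈ lcs G 3 :=
  com_mem le_rfl (d_mem x y) (mem_lcs_one x)

theorem g_mem (x y : G) : com (com y x) y ∈ lcs G 3 :=
  com_mem le_rfl (d_mem x y) (mem_lcs_one y)

namespace SchurRel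

variable {x y : G} (h : SchurRel x y)
include h

/-- Each layer is generated by commutators of generators of the previous layer with `x` and `y`. -/
theorem gens_succ {i : ℕ} (hi : 1 ≤ i) {S T : Set G} (hS : Gens i S) (hT : T ⊆ lcs G (i + 1))
    (hx : ∀ s ∈ S, ∃ t ∈ Subgroup.closure T, LcsEq (i + 2) (com s x) t)
    (hy : ∀ s ∈ S, ∃ t ∈ Subgroup.closure T, LcsEq (i + 2) (com s y) t) : Gens (i + 1) T := by
  refine ⟨hT, lcs_succ_le hi fun a ha b => ?_⟩
  refine com_mem_of_gen hi le_rfl hS.1 h.gens_one.1 hS.2 h.gens_one.2 le_sup_right ?_ ha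
    (mem_lcs_one b)
  have key : ∀ u t, t ∈ Subgroup.closure T → LcsEq (i + 2) u t →
      u ∈ Subgroup.closure T ⊔ lcs G (i + 1 + 1) := fun u t ht hut => by
    have := mul_mem (SetLike.le_def.1 le_sup_left ht)
      (SetLike.le_def.1 (le_sup_right (a := Subgroup.closure T)) (LcsEq.iff_mem.1 hut.symm))
    simpa using this
  rintro s hs t (rfl | rfl)
  · obtain ⟨v, hv, hv'⟩ := hx s hs
    exact key _ v hv hv'
  · obtain ⟨v, hv, hv'⟩ := hy s hs
    exact key _ v hv hv'

theorem gens_two : Gens 2 ({com y x} : Set G) := by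
  have hd : com y x ∈ Subgroup.closure ({com y x} : Set G) :=
    Subgroup.subset_closure rfl
  refine h.gens_succ le_rfl h.gens_one (by simpa using d_mem x y) ?_ ?_
  · rintro s (rfl | rfl)
    · exact ⟨1, one_mem _, .of_eq _ (com_self _)⟩
    · exact ⟨_, hd, .refl _ _⟩
  · rintro s (rfl | rfl)
    · exact ⟨_, inv_mem hd, .of_eq _ (com_swap _ _)⟩
    · exact ⟨1, one_mem _, .of_eq _ (com_self _)⟩

/-- This is `[y, x³] = 1` expanded and collected; `[e, x]` already stands last, so only `d` and `e`
have to be exchanged. -/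
theorem d_cube_collect : LcsEq 5 1
    (com y x ^ 3 * com (com y x) x ^ 3 * com (com (com y x) x) x) := by
  have h1 := LcsEq.of_eq 5 (com_cube_right y x)
  rw [h.com_x_cube] at h1
  exact h1.trans (collect_three' (H := G ⧸ lcs G 5) (d := com y x) (e := com (com y x) x)
    (f := com (com (com y x) x) x)
    (LcsEq.commute (k := 5) (by omega) (e_mem x y) (d_mem x y)))

theorem d_cube_mem : com y x ^ 3 ∈ lcs G 4 := by
  have h1 := h.d_cube_collect.mono (k := 4) (by omega)
  have he := LcsEq.one_iff.2 (h.cubeSucc 3 (by omega) _ (e_mem x y))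
  have hf := LcsEq.one_iff.2 (com_mem (k := 4) le_rfl (e_mem x y) (mem_lcs_one x))
  have h2 := ((LcsEq.refl 4 (com y x ^ 3)).mul he).mul hf
  simpa using LcsEq.one_iff.1 (h2.symm.trans h1.symm)

theorem cubeSuccSucc : CubeSuccSucc G :=
  cubeSuccSucc_of_gens h.cubeSucc h.gens_two (by
    rintro s rfl
    exact h.d_cube_mem)

/-- `[d, x, x] ≡ d⁻³`, where `d = [y, x]`. -/
theorem com_e_x : LcsEq 5 (com (com (com y x) x) x) (com y x ^ 3)⁻¹ := by
  have he := LcsEq.one_iff.2 (h.cubeSuccSucc 3 (by omega) _ (e_mem x y))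
  have h2 := ((LcsEq.refl 5 (com y x ^ 3)).mul he).mul
    (LcsEq.refl 5 (com (com (com y x) x) x))
  have h3 := (LcsEq.refl 5 (com y x ^ 3)⁻¹).mul (h.d_cube_collect.trans h2)
  simpa using h3.symm

theorem y_pow_six : LcsEq 4 (y ^ 6) (com (com y x) x)⁻¹ := by
  -- Since `x³` commutes with `y`, `x y x⁻¹ = x⁻² y x²`, which avoids commutators with `x⁻¹`. The
  -- relation then becomes a word with six `y`, three `d` and one `e`; modulo `lcs G 4` it collects
  -- to `y⁶ d³ e`, with `d³` trivial.
  have hY : x * y * x⁻¹ = y * com y x * com y x * com (com y x) x := by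
    have h1 : x ^ 3 * y = y * x ^ 3 := by
      have := h.com_x_cube
      rw [mul_com y, this, mul_one]
    calc x * y * x⁻¹ = (x ^ 2)⁻¹ * (x ^ 3 * y) * x⁻¹ := by group
      _ = (x ^ 2)⁻¹ * (y * x ^ 3) * x⁻¹ := by rw [h1]
      _ = _ := by simp [com, pow_succ, mul_assoc]
  have hrel : y * (y * com y x * com y x * com (com y x) x) * y * (y * (y * com y x) * y) = 1 := by
    rw [← hY]
    have h2 : y * (y * com y x) * y = y * x⁻¹ * y * x * y := by simp [com, mul_assoc]
    rw [h2, show y * (x * y * x⁻¹) * y = y * x * y * x⁻¹ * y by group, h.rel]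
    group
  have hd3 : LcsEq 4 (com y x ^ 3) 1 := LcsEq.one_iff.2 h.d_cube_mem
  have hcy : LcsEq 4 (com y x * y ^ 3) (y ^ 3 * com y x) :=
    LcsEq.commute (by omega) (d_mem x y) h.y_cube
  have hce : ∀ b, LcsEq 4 (com (com y x) x * b) (b * com (com y x) x) := fun b =>
    LcsEq.commute le_rfl (e_mem x y) (mem_lcs_one b)
  generalize com (com y x) x = e at *
  generalize com y x = d at *
  have key : ∀ {H : Type _} [Group H] (y d e : H), (y * (y * d * d * e) * y * (y * (y * d) * y) = 1) →
      d ^ 3 = 1 → d * y ^ 3 = y ^ 3 * d → e * y = y * e → e * d = d * e → y ^ 6 = e⁻¹ := by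
    intro H _ y d e h0 h1 h2 h3 h4
    have hey : e * y ^ 3 = y ^ 3 * e := ((show Commute e y from h3).pow_right 3)
    have e1 : y * (y * d * d * e) * y * (y * (y * d) * y) = y ^ 2 * d ^ 2 * (e * y ^ 3) * d * y := by
      simp [pow_succ, mul_assoc]
    have e2 : y ^ 2 * d ^ 2 * (e * y ^ 3) * d * y = y ^ 2 * d * (d * y ^ 3) * (e * d) * y := by
      rw [hey]; simp [pow_succ, mul_assoc]
    have e3 : y ^ 2 * d * (d * y ^ 3) * (e * d) * y = y ^ 2 * (d * y ^ 3) * d * d * (e * y) := by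
      have : y ^ 2 * d * (d * y ^ 3) * (e * d) * y = y ^ 2 * d * (y ^ 3 * d) * (d * e) * y := by
        rw [h2, h4]
      rw [this]; simp [mul_assoc]
    have e4 : y ^ 2 * (d * y ^ 3) * d * d * (e * y) = y ^ 5 * d ^ 3 * y * e := by
      rw [h2, h3]; simp [pow_succ, mul_assoc]
    rw [e1, e2, e3, e4, h1] at h0
    rw [eq_inv_iff_mul_eq_one, ← h0]
    simp [pow_succ, mul_assoc]
  exact key (H := G ⧸ lcs G 4) (y : G ⧸ lcs G 4) d e (LcsEq.of_eq 4 hrel) hd3 hcy (hce y) (hce d)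

/-- Both `y⁹ = (y³)³` and `y⁶` lie in `lcs G 3`, and `y³` is their quotient. -/
theorem y_cube_mem : y ^ 3 ∈ lcs G 3 := by
  have h6 : y ^ 6 ∈ lcs G 3 := h.y_pow_six.mem_of_le (by omega) (inv_mem (e_mem x y))
  have h9 := h.cubeSucc 2 (by omega) _ h.y_cube
  have := mul_mem h9 (inv_mem h6)
  rwa [show (y ^ 3) ^ 3 * (y ^ 6)⁻¹ = y ^ 3 by group] at this

/-- `y³ ≡ [d, x]`, where `d = [y, x]`. -/
theorem y_cube_lcsEq : LcsEq 4 (y ^ 3) (com (com y x) x) := by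
  have h9 := LcsEq.one_iff.2 (h.cubeSucc 3 (by omega) _ h.y_cube_mem)
  have := h9.mul h.y_pow_six.inv
  rwa [show (y ^ 3) ^ 3 * (y ^ 6)⁻¹ = y ^ 3 by group, one_mul, inv_inv] at this

/-- Modulo `lcs G 4`, `e` is `y³`, which commutes with `y`. -/
theorem com_e_y : com (com (com y x) x) y ∈ lcs G 5 := by
  have h1 := LcsEq.com_left (k := 5) le_rfl h.y_cube_lcsEq (mem_lcs_one y)
  have h2 : com (y ^ 3) y = 1 := by simp [com, pow_succ, mul_assoc]
  rw [h2] at h1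
  exact LcsEq.one_iff.1 h1.symm

/-- Jacobi for `d, x, y`: one term is `[e, y]`, and `[[x, y], d]` vanishes because `[x, y] = d⁻¹`.
-/
theorem com_g_x : com (com (com y x) y) x ∈ lcs G 5 := by
  have h1 := LcsEq.jacobi (k := 5) (by omega) le_rfl le_rfl le_rfl (d_mem x y) (mem_lcs_one x)
    (mem_lcs_one y)
  have h3 : com (com x y) (com y x) = 1 := by
    rw [com_swap y x]; generalize com y x = d; simp [com]
  rw [h3, mul_one, com_swap (com y x) y] at h1
  have h4 := (LcsEq.one_iff.2 h.com_e_y).symm.mul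
    (LcsEq.inv_left (k := 5) (by omega) (g_mem x y) (mem_lcs_one x)).symm
  have h5 := h4.trans h1
  rw [one_mul] at h5
  exact inv_mem_iff.1 (LcsEq.one_iff.1 h5)

/-- `[d, y, y] ≡ d³`, where `d = [y, x]`. -/
theorem com_g_y : LcsEq 5 (com (com (com y x) y) y) (com y x ^ 3) := by
  -- Compute `[y³, x]` twice modulo `lcs G 5`: it is `[e, x] ≡ d⁻³`, and by expansion `d³ [g, y]`.
  -- So `[g, y] ≡ d⁻⁶`, which is `d³` because `d⁹` lies in `lcs G 5`.
  have h1 := LcsEq.com_left (k := 5) le_rfl h.y_cube_lcsEq (mem_lcs_one x)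
  have hf : com (com (com y x) y) y ∈ lcs G 4 := com_mem le_rfl (g_mem x y) (mem_lcs_one y)
  have h2 : LcsEq 5 (com (y ^ 3) x)
      (com y x ^ 3 * com (com y x) y ^ 3 * com (com (com y x) y) y) := by
    rw [com_cube]
    exact collect_three (H := G ⧸ lcs G 5) (d := com y x) (e := com (com y x) y)
      (f := com (com (com y x) y) y)
      (LcsEq.commute (k := 5) (by omega) (g_mem x y) (d_mem x y))
      (LcsEq.commute (k := 5) (by omega) hf (d_mem x y))
      (LcsEq.commute (k := 5) (by omega) hf (g_mem x y))
  have hg := LcsEq.one_iff.2 (h.cubeSuccSucc 3 (by omega) _ (g_mem x y))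
  have h3 := ((LcsEq.refl 5 (com y x ^ 3)).mul hg).mul
    (LcsEq.refl 5 (com (com (com y x) y) y))
  have h4 := (h2.trans h3).symm.trans (h1.trans h.com_e_x)
  have h5 := (LcsEq.refl 5 (com y x ^ 3)⁻¹).mul h4
  have h9 := (LcsEq.one_iff.2 (h.cubeSucc 4 (by omega) _ h.d_cube_mem)).symm
  have h6 := h9.mul h5
  rw [mul_one, one_mul, inv_mul_cancel_left] at h6
  exact h6.trans (.of_eq _ (by group))

/-- Jacobi for `e, x, y`: the term with `[e, y]` drops out and `[[e, x], y] ≡ [d⁻³, y] ≡ g⁻³`.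
`com_d_g` is the same argument with `g` for `e`. -/
theorem com_d_e : LcsEq 6 (com (com y x) (com (com y x) x)) (com (com y x) y ^ 3)⁻¹ := by
  have h1 := LcsEq.jacobi (k := 6) (by omega) le_rfl le_rfl (by omega) (e_mem x y) (mem_lcs_one x)
    (mem_lcs_one y)
  have hA : LcsEq 6 (com (com y (com (com y x) x)) x) 1 := by
    rw [com_swap (com (com y x) x) y]
    exact LcsEq.one_iff.2 (com_mem le_rfl (inv_mem h.com_e_y) (mem_lcs_one x))
  have hB : LcsEq 6 (com (com x y) (com (com y x) x)) (com (com y x) (com (com y x) x))⁻¹ := by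
    rw [com_swap y x]
    exact LcsEq.inv_left (by omega) (d_mem x y) (e_mem x y)
  have hC : LcsEq 6 (com (com (com (com y x) x) x) y) (com (com y x) y ^ 3)⁻¹ :=
    (LcsEq.com_left le_rfl h.com_e_x (mem_lcs_one y)).trans
      ((LcsEq.inv_left (by omega) h.d_cube_mem (mem_lcs_one y)).trans
        (com_cube_lcsEq h.cubeSucc le_rfl (by omega) (d_mem x y) (mem_lcs_one y)).inv)
  have h2 := ((hC.mul hA).mul hB).symm.trans h1
  have h3 := h2.mul (LcsEq.refl 6 (com (com y x) (com (com y x) x)))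
  simpa using h3.symm

theorem com_d_g : LcsEq 6 (com (com y x) (com (com y x) y)) (com (com y x) x ^ 3)⁻¹ := by
  have h1 := LcsEq.jacobi (k := 6) (by omega) le_rfl le_rfl (by omega) (g_mem x y) (mem_lcs_one x)
    (mem_lcs_one y)
  have hA : LcsEq 6 (com (com (com (com y x) y) x) y) 1 :=
    LcsEq.one_iff.2 (com_mem le_rfl h.com_g_x (mem_lcs_one y))
  have hB : LcsEq 6 (com (com x y) (com (com y x) y)) (com (com y x) (com (com y x) y))⁻¹ := by
    rw [com_swap y x]
    exact LcsEq.inv_left (by omega) (d_mem x y) (g_mem x y)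
  have hC : LcsEq 6 (com (com y (com (com y x) y)) x) (com (com y x) x ^ 3)⁻¹ := by
    rw [com_swap (com (com y x) y) y]
    exact (LcsEq.com_left le_rfl h.com_g_y.inv (mem_lcs_one x)).trans
      ((LcsEq.inv_left (by omega) h.d_cube_mem (mem_lcs_one x)).trans
        (com_cube_lcsEq h.cubeSucc le_rfl (by omega) (d_mem x y) (mem_lcs_one x)).inv)
  have h2 := ((hA.mul hC).mul hB).symm.trans h1
  have h3 := h2.mul (LcsEq.refl 6 (com (com y x) (com (com y x) y)))
  simpa using h3.symm

/-- Jacobi for `d, y, e`: the term with `[y, e]` drops out and `[[e, d], y] ≡ [g³, y] ≡ [g, y]³ ≡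
d⁹`. -/
theorem com_e_g : LcsEq 7 (com (com (com y x) x) (com (com y x) y)) ((com y x ^ 3) ^ 3) := by
  have h1 := LcsEq.jacobi (k := 7) (by omega) le_rfl (by omega) (by omega) (d_mem x y)
    (mem_lcs_one y) (e_mem x y)
  have hA : LcsEq 7 (com (com y (com (com y x) x)) (com y x)) 1 := by
    rw [com_swap (com (com y x) x) y]
    exact LcsEq.one_iff.2 (com_mem le_rfl (inv_mem h.com_e_y) (d_mem x y))
  have hB : LcsEq 7 (com (com (com (com y x) x) (com y x)) y) ((com y x ^ 3) ^ 3) := by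
    rw [com_swap (com y x) (com (com y x) x)]
    have h2 := h.com_d_e.inv
    rw [inv_inv] at h2
    exact (LcsEq.com_left le_rfl h2 (mem_lcs_one y)).trans
      ((com_cube_lcsEq h.cubeSucc (by omega) (by omega) (g_mem x y) (mem_lcs_one y)).trans
      (cube_congr h.cubeSucc h.cubeSuccSucc (m := 4) (by omega)
        (com_mem le_rfl (g_mem x y) (mem_lcs_one y)) h.com_g_y))
  rw [com_swap (com (com y x) x) (com (com y x) y)] at h1
  have h2 := (((LcsEq.refl 7 _).mul hB).mul hA).symm.trans h1
  have h3 := (LcsEq.refl 7 (com (com (com y x) x) (com (com y x) y))).mul h2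
  simpa using h3.symm

end SchurRel

end Relations

/-! ### Layers of the lower central series: generators and orders. -/

section Structure

variable {G : Type*} [Group G]

theorem com_pow_pow_lcsEq (hw : CubeSucc G) (hs : CubeSuccSucc G) {i j : ℕ} (hi : 2 ≤ i)
    (hj : 2 ≤ j) {a b : G} (ha : a ∈ lcs G i) (hb : b ∈ lcs G j) (k l : ℕ) :
    LcsEq (i + j + 1 + 2 * (k + l)) (com (a ^ 3 ^ k) (b ^ 3 ^ l)) (com a b ^ 3 ^ (k + l)) := by
  have hB := pow_mem_lcs hs hj hb l
  have h1 : LcsEq (i + j + 2 * l + 1) (com a (b ^ 3 ^ l)) (com a b ^ 3 ^ l) := by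
    rw [com_swap (b ^ 3 ^ l) a, com_swap b a, inv_pow]
    exact ((com_pow_lcsEq hw hs hj hb ha l).mono (by omega)).inv
  have h2 := pow_congr hw hs (m := i + j + 2 * l) (by omega)
    (com_mem (by omega) ha hB) h1 k
  rw [add_comm k l, pow_add, pow_mul]
  exact ((com_pow_lcsEq hw hs hi ha hB k).mono (by omega)).trans (h2.mono (by omega))

theorem normal_of_lcs_le {i : ℕ} {M : Subgroup G} (h1 : lcs G (i + 1) ≤ M) (h2 : M ≤ lcs G i) :
    M.Normal := by
  refine ⟨fun m hm g => ?_⟩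
  have : g * m * g⁻¹ = m * com m g⁻¹ := by simp [com, mul_assoc]
  rw [this]
  exact mul_mem hm (h1 (com_mem le_rfl (h2 hm) (mem_lcs_one _)))

theorem card_closure_sup_le [Finite G] (N : Subgroup G) [N.Normal] (a : G) (ha : a ^ 3 ∈ N) :
    Nat.card (Subgroup.closure {a} ⊔ N : Subgroup G) ≤ 3 * Nat.card N := by
  have key : ∀ b ∈ Subgroup.closure {a} ⊔ N, ∃ (r : Fin 3) (u : N), b = a ^ (r : ℕ) * u := by
    intro b hb
    rw [Subgroup.mem_sup_of_normal_right] at hb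
    obtain ⟨v, hv, u, hu, rfl⟩ := hb
    obtain ⟨m, rfl⟩ := Subgroup.mem_closure_singleton.1 hv
    have hr : (m % 3).toNat < 3 := by omega
    have h3 : a ^ (3 * (m / 3)) ∈ N := by
      rw [zpow_mul]; exact zpow_mem (by exact_mod_cast ha) _
    refine ⟨⟨(m % 3).toNat, hr⟩, ⟨a ^ (3 * (m / 3)) * u, mul_mem h3 hu⟩, ?_⟩
    have hm : m = ((m % 3).toNat : ℤ) + 3 * (m / 3) := by omega
    rw [← mul_assoc, ← zpow_natCast a, ← zpow_add, ← hm]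
  choose! r u hru using key
  generalize Subgroup.closure {a} ⊔ N = M at *
  have hinj : Function.Injective (fun b : M => (r b, u b)) := by
    intro b c hbc
    rw [Prod.mk.injEq] at hbc
    exact Subtype.ext ((hru b b.2).trans (by rw [hbc.1, hbc.2, ← hru c c.2]))
  simpa using Nat.card_le_card_of_injective _ hinj

theorem card_lcs_le_of_gens_singleton [Finite G] {i : ℕ} {a : G} (h : Gens i {a})
    (ha : a ^ 3 ∈ lcs G (i + 1)) : Nat.card (lcs G i) ≤ 3 * Nat.card (lcs G (i + 1)) :=
  (Subgroup.card_le_of_le h.2).trans (card_closure_sup_le _ a ha)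

theorem card_lcs_le_of_gens_pair [Finite G] {i : ℕ} {a b : G} (h : Gens i {a, b})
    (ha : a ^ 3 ∈ lcs G (i + 1)) (hb : b ^ 3 ∈ lcs G (i + 1)) :
    Nat.card (lcs G i) ≤ 9 * Nat.card (lcs G (i + 1)) := by
  have hbi : b ∈ lcs G i := h.1 (Or.inr rfl)
  have : (Subgroup.closure {b} ⊔ lcs G (i + 1)).Normal :=
    normal_of_lcs_le le_sup_right
      (sup_le ((Subgroup.closure_le _).2 (by simpa using hbi)) (lcs_anti (by omega)))
  have h2 : lcs G i ≤ Subgroup.closure {a} ⊔ (Subgroup.closure {b} ⊔ lcs G (i + 1)) := by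
    rw [← sup_assoc, ← Subgroup.closure_union]
    exact h.2
  have h3 := card_closure_sup_le (Subgroup.closure {b} ⊔ lcs G (i + 1)) a
    (SetLike.le_def.1 le_sup_right ha)
  have h4 := card_closure_sup_le (lcs G (i + 1)) b hb
  have h5 := Subgroup.card_le_of_le h2
  omega

namespace SchurRel

variable {x y : G} (h : SchurRel x y)
include h

theorem com_e_pow_x (k : ℕ) :
    LcsEq (2 * k + 5) (com (com (com y x) x ^ 3 ^ k) x) (com y x ^ 3 ^ (k + 1))⁻¹ := by
  have h1 := com_pow_lcsEq h.cubeSucc h.cubeSuccSucc (by omega) (e_mem x y) (mem_lcs_one x) k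
  have h2 := pow_congr h.cubeSucc h.cubeSuccSucc (m := 4) (by omega)
    (com_mem le_rfl (e_mem x y) (mem_lcs_one x)) h.com_e_x k
  rw [inv_pow, ← pow_mul, ← pow_succ'] at h2
  exact (h1.mono (by omega)).trans (h2.mono (by omega))

theorem com_g_pow_y (k : ℕ) :
    LcsEq (2 * k + 5) (com (com (com y x) y ^ 3 ^ k) y) (com y x ^ 3 ^ (k + 1)) := by
  have h1 := com_pow_lcsEq h.cubeSucc h.cubeSuccSucc (by omega) (g_mem x y) (mem_lcs_one y) k
  have h2 := pow_congr h.cubeSucc h.cubeSuccSucc (m := 4) (by omega)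
    (com_mem le_rfl (g_mem x y) (mem_lcs_one y)) h.com_g_y k
  rw [← pow_mul, ← pow_succ'] at h2
  exact (h1.mono (by omega)).trans (h2.mono (by omega))

theorem com_pow_mem {a b : G} (ha : a ∈ lcs G 3) (hab : com a b ∈ lcs G 5) (k : ℕ) :
    com (a ^ 3 ^ k) b ∈ lcs G (2 * k + 5) := by
  have h1 := com_pow_lcsEq h.cubeSucc h.cubeSuccSucc (by omega) ha (mem_lcs_one b) k
  exact (h1.mono (by omega)).mem
    (lcs_anti (by omega) (pow_mem_lcs h.cubeSuccSucc (by omega) hab k))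

theorem d_pow_mem (k : ℕ) : com y x ^ 3 ^ k ∈ lcs G (2 * k + 2) :=
  lcs_anti (by omega) (pow_mem_lcs h.cubeSuccSucc le_rfl (d_mem x y) k)

theorem e_pow_mem (k : ℕ) : com (com y x) x ^ 3 ^ k ∈ lcs G (2 * k + 3) :=
  lcs_anti (by omega) (pow_mem_lcs h.cubeSuccSucc (by omega) (e_mem x y) k)

theorem g_pow_mem (k : ℕ) : com (com y x) y ^ 3 ^ k ∈ lcs G (2 * k + 3) :=
  lcs_anti (by omega) (pow_mem_lcs h.cubeSuccSucc (by omega) (g_mem x y) k)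

theorem gens_odd_of_even {k : ℕ} (hk : Gens (2 * k + 2) ({com y x ^ 3 ^ k} : Set G)) :
    Gens (2 * k + 3) ({com (com y x) x ^ 3 ^ k, com (com y x) y ^ 3 ^ k} : Set G) := by
  refine h.gens_succ (by omega) hk ?_ ?_ ?_
  · rintro s (rfl | rfl)
    exacts [h.e_pow_mem k, h.g_pow_mem k]
  · rintro s rfl
    exact ⟨_, Subgroup.subset_closure (Or.inl rfl),
      (com_pow_lcsEq h.cubeSucc h.cubeSuccSucc le_rfl (d_mem x y) (mem_lcs_one x) k).mono
        (by omega)⟩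
  · rintro s rfl
    exact ⟨_, Subgroup.subset_closure (Or.inr rfl),
      (com_pow_lcsEq h.cubeSucc h.cubeSuccSucc le_rfl (d_mem x y) (mem_lcs_one y) k).mono
        (by omega)⟩

/-- Taking `3^k`-th powers raises degrees by `2k` and preserves the low-degree relations: `[e, x]`
and `[g, y]` become `d^(3^(k+1))` up to inversion, while `[e, y]` and `[g, x]` contribute nothing.
-/
theorem gens_even (k : ℕ) : Gens (2 * k + 2) ({com y x ^ 3 ^ k} : Set G) := by
  induction k with
  | zero => simpa using h.gens_two
  | succ k ih =>
    have hd : com y x ^ 3 ^ (k + 1) ∈ Subgroup.closure ({com y x ^ 3 ^ (k + 1)} : Set G) :=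
      Subgroup.subset_closure rfl
    refine h.gens_succ (i := 2 * k + 3) (by omega) (h.gens_odd_of_even ih)
      (Set.singleton_subset_iff.2 (h.d_pow_mem (k + 1))) ?_ ?_
    · rintro s (rfl | rfl)
      · exact ⟨_, inv_mem hd, h.com_e_pow_x k⟩
      · exact ⟨1, one_mem _, LcsEq.one_iff.2 (h.com_pow_mem (g_mem x y) h.com_g_x k)⟩
    · rintro s (rfl | rfl)
      · exact ⟨1, one_mem _, LcsEq.one_iff.2 (h.com_pow_mem (e_mem x y) h.com_e_y k)⟩
      · exact ⟨_, hd, h.com_g_pow_y k⟩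

theorem gens_odd (k : ℕ) :
    Gens (2 * k + 3) ({com (com y x) x ^ 3 ^ k, com (com y x) y ^ 3 ^ k} : Set G) :=
  h.gens_odd_of_even (h.gens_even k)

theorem lcs_eq_bot [Group.IsNilpotent G] {n : ℕ} (hn : 1 ≤ n) (hpow : x ^ 3 = y ^ 3 ^ n) :
    lcs G (2 * n + 2) = ⊥ := by
  obtain ⟨k, rfl⟩ := Nat.exists_eq_add_of_le' hn
  -- With `n = k + 1`: `x³ = (y³)^(3^k) ≡ e^(3^k)`. Taking commutators with `x` kills the left side
  -- and gives `d^(3^(k+1))` on the right, so the generator of the layer `2n + 2` is trivial there.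
  have h1 := pow_congr h.cubeSucc h.cubeSuccSucc (by omega) h.y_cube_mem h.y_cube_lcsEq k
  rw [← pow_mul, ← pow_succ', ← hpow] at h1
  have h2 := (LcsEq.com_left (k := 2 * k + 5) (by omega) h1 (mem_lcs_one x)).trans (h.com_e_pow_x k)
  have h3 : com (x ^ 3) x = 1 := by simp [com, pow_succ, mul_assoc]
  rw [h3] at h2
  have h4 : com y x ^ 3 ^ (k + 1) ∈ lcs G (2 * k + 5) :=
    inv_mem_iff.1 (LcsEq.one_iff.1 h2.symm)
  have h5 := (h.gens_even (k + 1)).2.trans (sup_le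
    ((Subgroup.closure_le _).2 (Set.singleton_subset_iff.2 h4)) le_rfl)
  exact eq_bot_iff.2 (lcs_le_of_le_sup (by omega) (h5.trans le_sup_right))

theorem card_le [Finite G] (k : ℕ) : Nat.card G ≤ 9 * 27 ^ k * Nat.card (lcs G (2 * k + 2)) := by
  induction k with
  | zero =>
    have := card_lcs_le_of_gens_pair h.gens_one h.x_cube h.y_cube
    rw [lcs_one, Subgroup.card_top] at this
    simpa using this
  | succ k ih =>
    have h1 : Nat.card (lcs G (2 * k + 2)) ≤ 3 * Nat.card (lcs G (2 * k + 3)) :=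
      card_lcs_le_of_gens_singleton (h.gens_even k)
        (h.cubeSucc _ (by omega) _ (h.d_pow_mem k))
    have h2 := card_lcs_le_of_gens_pair (h.gens_odd k) (h.cubeSucc _ (by omega) _ (h.e_pow_mem k))
      (h.cubeSucc _ (by omega) _ (h.g_pow_mem k))
    calc Nat.card G ≤ 9 * 27 ^ k * Nat.card (lcs G (2 * k + 2)) := ih
      _ ≤ 9 * 27 ^ k * (3 * (9 * Nat.card (lcs G (2 * k + 3 + 1)))) := by gcongr; omega
      _ = _ := by ring_nf

theorem card_le_of_lcs_eq_bot [Finite G] {n : ℕ} (hn : lcs G (2 * n + 2) = ⊥) :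
    Nat.card G ≤ 3 ^ (3 * n + 2) := by
  have h1 := h.card_le n
  rw [hn, Subgroup.card_bot] at h1
  rw [pow_add, pow_mul]
  norm_num
  omega

/-- Without the last layer the layer bounds give order at most `3^(3n)`. -/
theorem lcs_ne_bot [Finite G] {n : ℕ} (hn : 1 ≤ n) (hcard : Nat.card G = 3 ^ (3 * n + 2)) :
    lcs G (2 * n + 1) ≠ ⊥ := by
  intro hbot
  obtain ⟨k, rfl⟩ := Nat.exists_eq_add_of_le' hn
  have h1 := h.card_le k
  have h2 := card_lcs_le_of_gens_singleton (h.gens_even k)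
    (h.cubeSucc _ (by omega) _ (h.d_pow_mem k))
  rw [show 2 * k + 2 + 1 = 2 * (k + 1) + 1 by ring, hbot, Subgroup.card_bot] at h2
  have h3 : 9 * 27 ^ k * Nat.card (lcs G (2 * k + 2)) ≤ 9 * 27 ^ k * 3 := by gcongr
  have h4 : 3 ^ (3 * (k + 1) + 2) = 9 * 27 ^ k * 27 := by
    rw [show 3 * (k + 1) + 2 = 3 * k + 5 by ring, pow_add, pow_mul]; norm_num; omega
  have h5 : 0 < 9 * 27 ^ k := by positivity
  nlinarith

/-! ### Commutators of lower central terms, and the derived series. -/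

theorem commutator_lcs_odd [Group.IsNilpotent G] (k : ℕ) :
    ⁅lcs G (2 * k + 3), lcs G (2 * k + 3)⁆ = lcs G (4 * k + 6) := by
  refine le_antisymm ((commutator_lcs_le _ _).trans (lcs_anti (by omega))) ?_
  refine lcs_le_of_le_sup (by omega) ?_
  have hg := (h.gens_even (2 * k + 2)).2
  rw [show 2 * (2 * k + 2) + 2 = 4 * k + 6 by ring] at hg
  refine hg.trans (sup_le ((Subgroup.closure_le _).2 ?_) le_sup_right)
  rintro _ rfl
  -- `[e^(3^k), g^(3^k)] ≡ [e, g]^(3^(2k)) ≡ d^(3^(2k+2))` generates the layer `4k + 6`.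
  have h1 := com_pow_pow_lcsEq h.cubeSucc h.cubeSuccSucc (by omega) (by omega) (e_mem x y)
    (g_mem x y) k k
  have h2 := pow_congr h.cubeSucc h.cubeSuccSucc (m := 6) (by omega)
    (com_mem le_rfl (e_mem x y) (g_mem x y)) h.com_e_g (k + k)
  have h3 : LcsEq (4 * k + 6 + 1) (com (com (com y x) x ^ 3 ^ k) (com (com y x) y ^ 3 ^ k))
      (com y x ^ 3 ^ (2 * k + 2)) := by
    refine ((h1.trans h2).mono (by omega)).trans (.of_eq _ ?_)
    rw [← pow_mul, ← pow_mul]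
    congr 1
    ring
  have h4 : com (com (com y x) x ^ 3 ^ k) (com (com y x) y ^ 3 ^ k) ∈
      ⁅lcs G (2 * k + 3), lcs G (2 * k + 3)⁆ := by
    rw [com_eq]
    exact Subgroup.commutator_mem_commutator (inv_mem (h.e_pow_mem k)) (inv_mem (h.g_pow_mem k))
  have h5 := mul_mem (SetLike.le_def.1 le_sup_left h4)
    (SetLike.le_def.1 (le_sup_right (a := ⁅lcs G (2 * k + 3), lcs G (2 * k + 3)⁆))
      (LcsEq.iff_mem.1 h3))
  rwa [mul_inv_cancel_left] at h5

/-- The layer `2k + 2` is cyclic, so commutators drop one degree beyond `4k + 4`. Conversely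
`[d^(3^k), g^(3^k)]` and `[d^(3^k), e^(3^k)]` give both generators of the layer `4k + 5`. -/
theorem commutator_lcs_even [Group.IsNilpotent G] (k : ℕ) :
    ⁅lcs G (2 * k + 2), lcs G (2 * k + 2)⁆ = lcs G (4 * k + 5) := by
  apply le_antisymm
  · rw [Subgroup.commutator_le]
    intro a ha b hb
    have := com_mem_of_gen (by omega) (by omega) (h.gens_even k).1 (h.gens_even k).1
      (h.gens_even k).2 (h.gens_even k).2 (P := lcs G (4 * k + 5)) (lcs_anti (by omega))
      (by rintro s rfl t rfl; rw [com_self]; exact one_mem _) (inv_mem ha) (inv_mem hb)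
    rwa [com_eq, inv_inv, inv_inv] at this
  · refine lcs_le_of_le_sup (by omega) ?_
    have hg := (h.gens_odd (2 * k + 1)).2
    rw [show 2 * (2 * k + 1) + 3 = 4 * k + 5 by ring] at hg
    refine hg.trans (sup_le ((Subgroup.closure_le _).2 ?_) le_sup_right)
    have key : ∀ {u v : G}, u ∈ lcs G 3 → u ^ 3 ^ k ∈ lcs G (2 * k + 2) →
        LcsEq 6 (com (com y x) u) (v ^ 3)⁻¹ → v ^ 3 ^ (2 * k + 1) ∈
          ⁅lcs G (2 * k + 2), lcs G (2 * k + 2)⁆ ⊔ lcs G (4 * k + 5 + 1) := by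
      intro u v hu huk huv
      have h1 := com_pow_pow_lcsEq h.cubeSucc h.cubeSuccSucc le_rfl (by omega) (d_mem x y)
        hu k k
      have h2 := pow_congr h.cubeSucc h.cubeSuccSucc (m := 5) (by omega)
        (com_mem le_rfl (d_mem x y) hu) huv (k + k)
      have h3 : LcsEq (4 * k + 5 + 1) (com (com y x ^ 3 ^ k) (u ^ 3 ^ k))
          (v ^ 3 ^ (2 * k + 1))⁻¹ := by
        refine ((h1.trans h2).mono (by omega)).trans (.of_eq _ ?_)
        rw [inv_pow, ← pow_mul]
        congr 2
        ring
      have h4 : com (com y x ^ 3 ^ k) (u ^ 3 ^ k) ∈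
          ⁅lcs G (2 * k + 2), lcs G (2 * k + 2)⁆ := by
        rw [com_eq]
        exact Subgroup.commutator_mem_commutator (inv_mem (h.d_pow_mem k)) (inv_mem huk)
      have h5 := mul_mem (SetLike.le_def.1 le_sup_left h4)
        (SetLike.le_def.1 (le_sup_right (a := ⁅lcs G (2 * k + 2), lcs G (2 * k + 2)⁆))
          (LcsEq.iff_mem.1 h3))
      rw [mul_inv_cancel_left] at h5
      exact inv_mem_iff.1 h5
    rintro _ (rfl | rfl)
    · exact key (g_mem x y) (lcs_anti (by omega) (h.g_pow_mem k)) h.com_d_g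
    · exact key (e_mem x y) (lcs_anti (by omega) (h.e_pow_mem k)) h.com_d_e

end SchurRel

/-- The index of the term of the lower central series that equals the `k`-th derived subgroup. -/
def derivedIndex : ℕ → ℕ
  | 0 => 1
  | k + 1 => 2 * derivedIndex k + if Even (derivedIndex k) then 1 else 0

/-- A closed form of the recursion `1, 2, 5, 10, 21, …`: the index is `⌊2^(k+2) / 3⌋`, which is
where the binary logarithm comes from. -/
theorem three_mul_derivedIndex (k : ℕ) :
    3 * derivedIndex k + (if Even (derivedIndex k) then 2 else 1) = 2 ^ (k + 2) := by
  induction k with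
  | zero => simp [derivedIndex]
  | succ k ih =>
    rw [derivedIndex, pow_succ]
    by_cases he : Even (derivedIndex k)
    · have : ¬ Even (2 * derivedIndex k + 1) := by simp
      simp only [he, if_true, this, if_false] at ih ⊢
      omega
    · have : Even (2 * derivedIndex k + 0) := by simp
      simp only [he, if_true, this, if_false] at ih ⊢
      omega

theorem le_derivedIndex_iff (n k : ℕ) : 2 * n + 2 ≤ derivedIndex k ↔ Nat.log 2 (3 * n + 3) ≤ k := by
  have h1 := three_mul_derivedIndex k
  have h2 : Nat.log 2 (3 * n + 3) ≤ k ↔ 3 * n + 3 < 2 ^ (k + 1) := by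
    rw [← Nat.lt_succ_iff, Nat.succ_eq_add_one, ← Nat.log_lt_iff_lt_pow (by norm_num) (by omega)]
  rw [h2]
  rw [pow_succ] at h1
  split_ifs at h1 <;> omega

theorem SchurRel.derivedSeries_eq [Group.IsNilpotent G] {x y : G} (h : SchurRel x y) (k : ℕ) :
    derivedSeries G k = lcs G (derivedIndex k) := by
  induction k with
  | zero => rfl
  | succ k ih =>
    rw [derivedSeries_succ, ih, derivedIndex]
    have h1 := three_mul_derivedIndex k
    split_ifs with he
    · obtain ⟨m, hm⟩ := he
      obtain ⟨j, rfl⟩ : ∃ j, m = j + 1 := by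
        refine Nat.exists_eq_add_of_le' (Nat.pos_of_ne_zero ?_)
        rintro rfl
        have : 2 ^ (k + 2) = 2 * 2 * 2 ^ k := by ring
        have : 0 < 2 ^ k := by positivity
        rw [hm] at h1
        simp at h1
        omega
      rw [hm, show j + 1 + (j + 1) = 2 * j + 2 by ring, h.commutator_lcs_even]
      congr 1
      ring
    · obtain ⟨m, hm⟩ := Nat.not_even_iff_odd.1 he
      rw [hm, add_zero]
      rcases m with _ | j
      · exact (lcs_succ le_rfl).symm
      · rw [show 2 * (j + 1) + 1 = 2 * j + 3 by ring, h.commutator_lcs_odd]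
        congr 1
        ring

theorem SchurRel.nilpotencyClass_eq [Finite G] [Group.IsNilpotent G] {x y : G} (h : SchurRel x y)
    {n : ℕ} (hn : 1 ≤ n) (hpow : x ^ 3 = y ^ 3 ^ n) (hcard : Nat.card G = 3 ^ (3 * n + 2)) :
    Group.nilpotencyClass G = 2 * n + 1 := by
  refine le_antisymm (Subgroup.lowerCentralSeries_eq_bot_iff_nilpotencyClass_le.1
    (h.lcs_eq_bot hn hpow)) ?_
  by_contra! hlt
  exact h.lcs_ne_bot hn hcard
    (Subgroup.lowerCentralSeries_eq_bot_iff_nilpotencyClass_le.2 (by omega))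

theorem SchurRel.hasDerivedLength {G : Type} [Group G] [Finite G] [Group.IsNilpotent G] {x y : G}
    (h : SchurRel x y) {n : ℕ} (hn : 1 ≤ n) (hpow : x ^ 3 = y ^ 3 ^ n)
    (hcard : Nat.card G = 3 ^ (3 * n + 2)) : HasDerivedLength G (Nat.log 2 (3 * n + 3)) := by
  have key : ∀ k, derivedSeries G k = ⊥ ↔ Nat.log 2 (3 * n + 3) ≤ k := by
    intro k
    rw [h.derivedSeries_eq, ← le_derivedIndex_iff]
    constructor
    · intro hk
      by_contra! hlt
      refine h.lcs_ne_bot hn hcard (eq_bot_iff.2 ?_)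
      rw [← hk]
      exact lcs_anti (by omega)
    · intro hk
      rw [eq_bot_iff, ← h.lcs_eq_bot hn hpow]
      exact lcs_anti hk
  exact ⟨(key _).2 le_rfl, fun k hk => (key k).1 hk⟩

/-- In a finite `3`-group the presentation of `GroupG n` implies the relations of `SchurRel`. -/
theorem IsPGroup.schurRel [Finite G] (hG : IsPGroup 3 G) {x y : G}
    (hgen : Subgroup.closure {x, y} = ⊤) {n : ℕ} (hn : 1 ≤ n)
    (hr : (x ^ 3 * y ^ (-(3 : ℤ) ^ n))⁻¹ * (x⁻¹ ^ 3 * y⁻¹ ^ (-(3 : ℤ) ^ n)) = 1)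
    (ht : (y * x * y * x⁻¹ * y)⁻¹ * (y⁻¹ * x⁻¹ * y⁻¹ * x * y⁻¹) = 1) :
    SchurRel x y ∧ x ^ 3 = y ^ 3 ^ n := by
  -- A common odd exponent `2m + 1` kills both elements, so `a^(2m) = b^(2m)` gives `a = b`.
  have sq_inj : ∀ {H : Type _} [Group H], IsPGroup 3 H → ∀ a b : H, a ^ 2 = b ^ 2 → a = b := by
    intro H _ hH a b hab
    obtain ⟨k, hk⟩ := hH a
    obtain ⟨l, hl⟩ := hH b
    have hodd : Odd (3 ^ (k + l)) := Odd.pow (by decide)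
    obtain ⟨m, hm⟩ := hodd
    have ha : a ^ 3 ^ (k + l) = 1 := by rw [pow_add, pow_mul, hk, one_pow]
    have hb : b ^ 3 ^ (k + l) = 1 := by rw [add_comm, pow_add, pow_mul, hl, one_pow]
    rw [hm, pow_succ, pow_mul] at ha hb
    rw [hab] at ha
    exact mul_left_cancel (ha.trans hb.symm)
  have hpow : x ^ 3 = y ^ 3 ^ n := by
    apply sq_inj hG
    have e1 : y ^ (-(3 : ℤ) ^ n) = (y ^ 3 ^ n)⁻¹ := by
      rw [zpow_neg, ← zpow_natCast]; norm_cast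
    have e2 : y⁻¹ ^ (-(3 : ℤ) ^ n) = y ^ 3 ^ n := by
      rw [inv_zpow, e1, inv_inv]
    rw [e1, e2] at hr
    generalize y ^ 3 ^ n = w at *
    have : (x ^ 3 * w⁻¹)⁻¹ * (x⁻¹ ^ 3 * w) = w * (x ^ 3 * x ^ 3)⁻¹ * w := by
      simp [mul_assoc]
    rw [this] at hr
    have h3 : (x ^ 3 * x ^ 3)⁻¹ = w⁻¹ * w⁻¹ := by
      have := congrArg (fun t => w⁻¹ * t * w⁻¹) hr
      simpa [mul_assoc] using this
    rw [sq, sq, ← inv_inj, h3, mul_inv_rev]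
  have hrel : y * x * y * x⁻¹ * y = y⁻¹ * x⁻¹ * y⁻¹ * x * y⁻¹ := inv_mul_eq_one.1 ht
  have hy3 : y ^ 3 ∈ lcs G 2 := by
    rw [← QuotientGroup.eq_one_iff]
    have hc : (x : G ⧸ lcs G 2) * y = y * x :=
      LcsEq.commute le_rfl (mem_lcs_one x) (mem_lcs_one y)
    have h1 := congrArg (QuotientGroup.mk : G → G ⧸ lcs G 2) hrel
    simp only [QuotientGroup.mk_mul, QuotientGroup.mk_inv] at h1
    have hcy : Commute (x : G ⧸ lcs G 2) y := hc
    rw [QuotientGroup.mk_pow]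
    generalize (x : G ⧸ lcs G 2) = X at *
    apply sq_inj (hG.to_quotient (lcs G 2))
    generalize (y : G ⧸ lcs G 2) = Y at *
    -- In the abelianization the second relation reads `Y³ = Y⁻³`, so `(Y³)² = 1`.
    have e1 : Y * X * Y * X⁻¹ * Y = Y ^ 3 := by
      rw [mul_assoc Y X Y, hc]; simp [pow_succ, mul_assoc]
    have e2 : Y⁻¹ * X⁻¹ * Y⁻¹ * X * Y⁻¹ = (Y ^ 3)⁻¹ := by
      rw [mul_assoc Y⁻¹ X⁻¹ Y⁻¹, hcy.inv_inv.eq]; simp [pow_succ, mul_assoc]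
    rw [e1, e2] at h1
    rw [one_pow, sq]
    nth_rewrite 1 [h1]
    exact inv_mul_cancel _
  refine ⟨⟨hgen, ?_, ?_, hy3, hrel⟩, hpow⟩
  · rw [hpow]
    have : Commute y (y ^ 3 ^ n) := (Commute.refl y).pow_right _
    simp only [com]
    rw [mul_assoc, this.eq]; group
  · rw [hpow]
    obtain ⟨k, rfl⟩ := Nat.exists_eq_add_of_le' hn
    rw [pow_succ', pow_mul]
    exact pow_mem hy3 _

end Structure

/-! ### The congruence filtration and leading terms. -/

section Congruence

variable {B : Type*} [CommRing B] {E : Type*} [Ring E] [Algebra B E]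

/-- The subgroup of units congruent to `1` modulo `ϖ ^ i`. -/
def congruenceSubgroup (E : Type*) [Ring E] [Algebra B E] (ϖ : B) (i : ℕ) : Subgroup Eˣ where
  carrier := {g | ∃ ν : E, (g : E) = 1 + ϖ ^ i • ν}
  one_mem' := ⟨0, by simp⟩
  mul_mem' := by
    rintro g h ⟨ν, hν⟩ ⟨μ, hμ⟩
    refine ⟨ν + μ + ϖ ^ i • (ν * μ), ?_⟩
    rw [Units.val_mul, hν, hμ]
    simp only [mul_add, add_mul, one_mul, mul_one, smul_mul_assoc, mul_smul_comm, smul_add]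
    abel
  inv_mem' := by
    rintro g ⟨ν, hν⟩
    refine ⟨-(((g⁻¹ : Eˣ) : E) * ν), ?_⟩
    have h : ((g⁻¹ : Eˣ) : E) * g = 1 := g.inv_mul
    rw [hν, mul_add, mul_one, mul_smul_comm] at h
    rw [smul_neg, ← sub_eq_add_neg, eq_sub_iff_add_eq, h]

/-- `g` has leading term `α` in degree `i`: it is `1 + ϖ ^ i α` modulo `ϖ ^ (i + 1)`. -/
def HasLeading (ϖ : B) (i : ℕ) (g : Eˣ) (α : E) : Prop :=
  ∃ ν : E, (g : E) = 1 + ϖ ^ i • α + ϖ ^ (i + 1) • ν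

variable {ϖ : B}

theorem congruenceSubgroup_anti {i j : ℕ} (h : i ≤ j) {g : Eˣ}
    (hg : g ∈ congruenceSubgroup E ϖ j) : g ∈ congruenceSubgroup E ϖ i := by
  obtain ⟨ν, hν⟩ := hg
  obtain ⟨k, rfl⟩ := Nat.exists_eq_add_of_le h
  exact ⟨ϖ ^ k • ν, by rw [hν, pow_add, mul_smul]⟩

theorem eq_one_of_mem_congruenceSubgroup {i : ℕ} (h : ϖ ^ i = 0) {g : Eˣ}
    (hg : g ∈ congruenceSubgroup E ϖ i) : g = 1 := by
  obtain ⟨ν, hν⟩ := hg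
  exact Units.ext (by simp [hν, h])

theorem cube_one_add_smul (hϖ : ϖ ^ 2 = 3) (i : ℕ) (A : E) :
    (1 + ϖ ^ i • A) ^ 3 =
      1 + ϖ ^ (i + 2) • A + ϖ ^ (i + i + 2) • A ^ 2 + ϖ ^ (i + i + i) • A ^ 3 := by
  have h3 : ∀ Z : E, ϖ ^ 2 • Z = 3 * Z := fun Z => by
    rw [hϖ, Algebra.smul_def, map_ofNat]
  have h4 : ∀ (j : ℕ) (Z : E), ϖ ^ (j + 2) • Z = 3 * ϖ ^ j • Z := fun j Z => by
    rw [add_comm, pow_add, mul_smul, h3]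
  rw [h4, h4]
  have h5 : ϖ ^ (i + i) • A ^ 2 = (ϖ ^ i • A) * (ϖ ^ i • A) := by
    rw [smul_mul_smul_comm, pow_add, sq]
  have h6 : ϖ ^ (i + i + i) • A ^ 3 = (ϖ ^ i • A) * (ϖ ^ i • A) * (ϖ ^ i • A) := by
    rw [smul_mul_smul_comm, smul_mul_smul_comm, pow_add, pow_add, pow_succ, sq]
  rw [h5, h6]
  generalize ϖ ^ i • A = Z
  noncomm_ring

theorem cube_mem_congruenceSubgroup (hϖ : ϖ ^ 2 = 3) {i : ℕ} (hi : 1 ≤ i) {g : Eˣ}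
    (hg : g ∈ congruenceSubgroup E ϖ i) : g ^ 3 ∈ congruenceSubgroup E ϖ (i + 2) := by
  obtain ⟨A, hA⟩ := hg
  obtain ⟨k, rfl⟩ := Nat.exists_eq_add_of_le' hi
  refine ⟨A + ϖ ^ (k + 1) • A ^ 2 + ϖ ^ (k + k) • A ^ 3, ?_⟩
  rw [Units.val_pow_eq_pow_val, hA, cube_one_add_smul hϖ, smul_add, smul_add, ← mul_smul,
    ← mul_smul, ← pow_add, ← pow_add]
  ring_nf
  abel

theorem pow_mem_congruenceSubgroup (hϖ : ϖ ^ 2 = 3) {g : Eˣ}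
    (hg : g ∈ congruenceSubgroup E ϖ 1) (k : ℕ) :
    g ^ 3 ^ k ∈ congruenceSubgroup E ϖ (2 * k + 1) := by
  induction k with
  | zero => simpa using hg
  | succ k ih =>
    rw [pow_succ, pow_mul]
    exact cube_mem_congruenceSubgroup hϖ (by omega) ih

theorem one_add_smul_mul_sub (s t : B) (P R : E) :
    (1 + s • P) * (1 + t • R) - (1 + t • R) * (1 + s • P) = (s * t) • (P * R - R * P) := by
  simp only [mul_add, add_mul, one_mul, mul_one, smul_mul_smul_comm, smul_sub, mul_comm t s]
  abel

theorem com_mem_congruenceSubgroup {i j : ℕ} {g h : Eˣ} (hg : g ∈ congruenceSubgroup E ϖ i)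
    (hh : h ∈ congruenceSubgroup E ϖ j) : com g h ∈ congruenceSubgroup E ϖ (i + j) := by
  obtain ⟨ν, hν⟩ := hg
  obtain ⟨μ, hμ⟩ := hh
  refine ⟨((g⁻¹ * h⁻¹ : Eˣ) : E) * (ν * μ - μ * ν), ?_⟩
  have h1 : ((com g h : Eˣ) : E) = 1 + ((g⁻¹ * h⁻¹ : Eˣ) : E) * ((g : E) * h - h * g) := by
    simp [com, mul_sub, ← mul_assoc]
  rw [h1, ← mul_smul_comm, hν, hμ, one_add_smul_mul_sub, pow_add]

namespace HasLeading

variable {i j : ℕ} {g h : Eˣ} {α β : E}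

theorem mem (hg : HasLeading ϖ i g α) : g ∈ congruenceSubgroup E ϖ i := by
  obtain ⟨ν, hν⟩ := hg
  exact ⟨α + ϖ • ν, by rw [hν, smul_add, ← mul_smul, ← pow_succ, add_assoc]⟩

theorem of_mem (hg : g ∈ congruenceSubgroup E ϖ (i + 1)) : HasLeading ϖ i g 0 := by
  obtain ⟨ν, hν⟩ := hg
  exact ⟨ν, by rw [hν, smul_zero, add_zero]⟩

theorem mul (hi : 1 ≤ i) (hg : HasLeading ϖ i g α) (hh : HasLeading ϖ i h β) :
    HasLeading ϖ i (g * h) (α + β) := by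
  obtain ⟨k, rfl⟩ := Nat.exists_eq_add_of_le' hi
  obtain ⟨ν, hν⟩ := hg
  obtain ⟨μ, hμ⟩ := hh
  have hν' : (g : E) = 1 + ϖ ^ (k + 1) • (α + ϖ • ν) := by
    rw [hν, smul_add, ← mul_smul, ← pow_succ, add_assoc]
  have hμ' : (h : E) = 1 + ϖ ^ (k + 1) • (β + ϖ • μ) := by
    rw [hμ, smul_add, ← mul_smul, ← pow_succ, add_assoc]
  refine ⟨ν + μ + ϖ ^ k • ((α + ϖ • ν) * (β + ϖ • μ)), ?_⟩
  have h2 : ϖ ^ (k + 1 + 1) • ϖ ^ k • ((α + ϖ • ν) * (β + ϖ • μ)) =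
      ϖ ^ (k + 1) • (α + ϖ • ν) * ϖ ^ (k + 1) • (β + ϖ • μ) := by
    rw [smul_mul_smul_comm, ← mul_smul, ← pow_add, ← pow_add]
    congr 2
    ring
  rw [smul_add (ϖ ^ (k + 1 + 1)) (ν + μ), h2, Units.val_mul, hν', hμ']
  have h3 : ∀ ρ : E, ϖ ^ (k + 1 + 1) • ρ = ϖ ^ (k + 1) • ϖ • ρ := fun ρ => by
    rw [← mul_smul, ← pow_succ]
  rw [h3]
  generalize hP : α + ϖ • ν = P
  generalize hR : β + ϖ • μ = R
  have h4 : ϖ ^ (k + 1) • (α + β) + ϖ ^ (k + 1) • ϖ • (ν + μ) = ϖ ^ (k + 1) • (P + R) := by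
    rw [← hP, ← hR]
    simp only [smul_add]
    abel
  rw [smul_add (ϖ ^ (k + 1)) P R] at h4
  have h5 : 1 + ϖ ^ (k + 1) • (α + β) +
      (ϖ ^ (k + 1) • ϖ • (ν + μ) + ϖ ^ (k + 1) • P * ϖ ^ (k + 1) • R) =
      1 + (ϖ ^ (k + 1) • (α + β) + ϖ ^ (k + 1) • ϖ • (ν + μ)) +
        ϖ ^ (k + 1) • P * ϖ ^ (k + 1) • R := by abel
  rw [h5, h4]
  simp only [add_mul, mul_add, one_mul, mul_one]
  abel

theorem pow (hi : 1 ≤ i) (hg : HasLeading ϖ i g α) (m : ℕ) :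
    HasLeading ϖ i (g ^ m) (m • α) := by
  induction m with
  | zero => exact ⟨0, by simp⟩
  | succ m ih =>
    rw [pow_succ, succ_nsmul]
    exact ih.mul hi hg

theorem com (hi : 1 ≤ i) (hj : 1 ≤ j) (hg : HasLeading ϖ i g α) (hh : HasLeading ϖ j h β) :
    HasLeading ϖ (i + j) (com g h) (α * β - β * α) := by
  obtain ⟨ρ, hρ⟩ : (g⁻¹ * h⁻¹) ∈ congruenceSubgroup E ϖ 1 :=
    mul_mem (inv_mem (congruenceSubgroup_anti hi hg.mem))
      (inv_mem (congruenceSubgroup_anti hj hh.mem))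
  obtain ⟨ν, hν⟩ := hg
  obtain ⟨μ, hμ⟩ := hh
  have hν' : (g : E) = 1 + ϖ ^ i • (α + ϖ • ν) := by
    rw [hν, smul_add, ← mul_smul, ← pow_succ, add_assoc]
  have hμ' : (h : E) = 1 + ϖ ^ j • (β + ϖ • μ) := by
    rw [hμ, smul_add, ← mul_smul, ← pow_succ, add_assoc]
  -- The group commutator differs from `1` by a unit multiple of the ring commutator `gh - hg`; that
  -- unit is `1` modulo `ϖ`, so only the Lie bracket of the leading terms survives.
  have h1 : ((_root_.com g h : Eˣ) : E) =
      1 + ((g⁻¹ * h⁻¹ : Eˣ) : E) * ((g : E) * h - h * g) := by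
    simp [_root_.com, mul_sub, ← mul_assoc]
  have h2 : (g : E) * h - h * g = ϖ ^ (i + j) •
      ((α + ϖ • ν) * (β + ϖ • μ) - (β + ϖ • μ) * (α + ϖ • ν)) := by
    rw [hν', hμ', one_add_smul_mul_sub, pow_add]
  have h3 : (α + ϖ • ν) * (β + ϖ • μ) - (β + ϖ • μ) * (α + ϖ • ν) = (α * β - β * α) +
      ϖ • (α * μ + ν * β + ϖ • (ν * μ) - β * ν - μ * α - ϖ • (μ * ν)) := by
    simp only [mul_add, add_mul, smul_mul_assoc, mul_smul_comm, smul_add, smul_sub]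
    abel
  rw [h3] at h2
  generalize α * μ + ν * β + ϖ • (ν * μ) - β * ν - μ * α - ϖ • (μ * ν) = τ at h2
  generalize α * β - β * α = γ at h2 ⊢
  refine ⟨τ + ρ * γ + ϖ • (ρ * τ), ?_⟩
  rw [h1, h2, hρ, pow_one, pow_succ, mul_smul, add_assoc, ← smul_add, mul_smul_comm]
  congr 2
  simp only [mul_add, add_mul, one_mul, smul_mul_assoc, mul_smul_comm, smul_add]
  abel

/-- Because `3 = ϖ²`, the linear term lands in degree `i + 2`. For `i = 1` the term `ϖ^(3i) α³`
would land there too, hence `2 ≤ i`. -/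
theorem cube (hϖ : ϖ ^ 2 = 3) (hi : 2 ≤ i) (hg : HasLeading ϖ i g α) :
    HasLeading ϖ (i + 2) (g ^ 3) α := by
  obtain ⟨k, rfl⟩ := Nat.exists_eq_add_of_le' hi
  obtain ⟨ν, hν⟩ := hg
  have hν' : (g : E) = 1 + ϖ ^ (k + 2) • (α + ϖ • ν) := by
    rw [hν, smul_add, ← mul_smul, ← pow_succ, add_assoc]
  refine ⟨ν + ϖ ^ (k + 1) • (α + ϖ • ν) ^ 2 + ϖ ^ (k + k + 1) • (α + ϖ • ν) ^ 3, ?_⟩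
  rw [Units.val_pow_eq_pow_val, hν', cube_one_add_smul hϖ]
  generalize (α + ϖ • ν) ^ 2 = P
  generalize (α + ϖ • ν) ^ 3 = R
  simp only [smul_add, ← mul_smul, ← pow_add, ← pow_succ]
  ring_nf
  abel

theorem pow_three_pow (hϖ : ϖ ^ 2 = 3) (hi : 2 ≤ i) (hg : HasLeading ϖ i g α) (k : ℕ) :
    HasLeading ϖ (i + 2 * k) (g ^ 3 ^ k) α := by
  induction k with
  | zero => simpa using hg
  | succ k ih =>
    rw [pow_succ, pow_mul]
    exact ih.cube (i := i + 2 * k) hϖ (by omega)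

theorem smul_sub_eq (hg : HasLeading ϖ i g α) (hg' : HasLeading ϖ i g β) :
    ∃ ν : E, ϖ ^ i • (α - β) = ϖ ^ (i + 1) • ν := by
  obtain ⟨ν, hν⟩ := hg
  obtain ⟨μ, hμ⟩ := hg'
  refine ⟨μ - ν, ?_⟩
  rw [hν] at hμ
  rw [smul_sub, smul_sub, sub_eq_sub_iff_add_eq_add]
  rw [add_assoc, add_assoc] at hμ
  rw [add_left_cancel hμ, add_comm]

end HasLeading

variable {A : Type*} [Group A] [Finite A] (π : A →* Eˣ)

/-- The nine products `u^a v^b` with `a, b < 3` have distinct leading terms, so they lie in distinct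
cosets of the next congruence subgroup. -/
theorem card_comap_congruenceSubgroup_pair {i : ℕ} (hi : 1 ≤ i) {u v : A} {α β : E}
    (hu : HasLeading ϖ i (π u) α) (hv : HasLeading ϖ i (π v) β)
    (hind : ∀ (a b : ℤ) (ν : E), ϖ ^ i • (a • α + b • β) = ϖ ^ (i + 1) • ν → 3 ∣ a ∧ 3 ∣ b) :
    9 * Nat.card ((congruenceSubgroup E ϖ (i + 1)).comap π) ≤
      Nat.card ((congruenceSubgroup E ϖ i).comap π) := by
  let f : (Fin 3 × Fin 3) × (congruenceSubgroup E ϖ (i + 1)).comap π →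
      (congruenceSubgroup E ϖ i).comap π := fun p =>
    ⟨u ^ (p.1.1 : ℕ) * v ^ (p.1.2 : ℕ) * p.2, mul_mem (mul_mem
      (Subgroup.pow_mem ((congruenceSubgroup E ϖ i).comap π) hu.mem _)
      (Subgroup.pow_mem ((congruenceSubgroup E ϖ i).comap π) hv.mem _))
      (congruenceSubgroup_anti (by omega) p.2.2)⟩
  have hf : Function.Injective f := by
    rintro ⟨⟨a, b⟩, w⟩ ⟨⟨a', b'⟩, w'⟩ h
    have h0 : u ^ (a : ℕ) * v ^ (b : ℕ) * (w : A) = u ^ (a' : ℕ) * v ^ (b' : ℕ) * w' :=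
      congrArg Subtype.val h
    have lead : ∀ (a b : Fin 3) (w : (congruenceSubgroup E ϖ (i + 1)).comap π),
        HasLeading ϖ i (π (u ^ (a : ℕ) * v ^ (b : ℕ) * w)) ((a : ℕ) • α + (b : ℕ) • β + 0) := by
      intro a b w
      rw [map_mul, map_mul, map_pow, map_pow]
      exact ((hu.pow hi a).mul hi (hv.pow hi b)).mul hi (HasLeading.of_mem w.2)
    have h1 := lead a b w
    rw [h0] at h1
    obtain ⟨ν, hν⟩ := h1.smul_sub_eq (lead a' b' w')
    have h2 : (a : ℕ) • α + (b : ℕ) • β + 0 - ((a' : ℕ) • α + (b' : ℕ) • β + 0) =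
        ((a : ℤ) - (a' : ℤ)) • α + ((b : ℤ) - (b' : ℤ)) • β := by
      simp only [sub_smul, natCast_zsmul]
      abel
    rw [h2] at hν
    obtain ⟨h3, h4⟩ := hind _ _ ν hν
    have ha : a = a' := Fin.ext (by omega)
    have hb : b = b' := Fin.ext (by omega)
    subst ha hb
    have hw : w = w' := Subtype.ext (mul_left_cancel h0)
    rw [hw]
  simpa using Nat.card_le_card_of_injective f hf

theorem card_comap_congruenceSubgroup_single {i : ℕ} (hi : 1 ≤ i) {u : A} {α : E}
    (hu : HasLeading ϖ i (π u) α)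
    (hind : ∀ (a : ℤ) (ν : E), ϖ ^ i • (a • α) = ϖ ^ (i + 1) • ν → 3 ∣ a) :
    3 * Nat.card ((congruenceSubgroup E ϖ (i + 1)).comap π) ≤
      Nat.card ((congruenceSubgroup E ϖ i).comap π) := by
  let f : Fin 3 × (congruenceSubgroup E ϖ (i + 1)).comap π →
      (congruenceSubgroup E ϖ i).comap π := fun p =>
    ⟨u ^ (p.1 : ℕ) * p.2, mul_mem
      (Subgroup.pow_mem ((congruenceSubgroup E ϖ i).comap π) hu.mem _)
      (congruenceSubgroup_anti (by omega) p.2.2)⟩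
  have hf : Function.Injective f := by
    rintro ⟨a, w⟩ ⟨a', w'⟩ h
    have h0 : u ^ (a : ℕ) * (w : A) = u ^ (a' : ℕ) * w' := congrArg Subtype.val h
    have lead : ∀ (a : Fin 3) (w : (congruenceSubgroup E ϖ (i + 1)).comap π),
        HasLeading ϖ i (π (u ^ (a : ℕ) * w)) ((a : ℕ) • α + 0) := by
      intro a w
      rw [map_mul, map_pow]
      exact (hu.pow hi a).mul hi (HasLeading.of_mem w.2)
    have h1 := lead a w
    rw [h0] at h1
    obtain ⟨ν, hν⟩ := h1.smul_sub_eq (lead a' w')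
    have h2 : (a : ℕ) • α + 0 - ((a' : ℕ) • α + 0) = ((a : ℤ) - (a' : ℤ)) • α := by
      simp only [sub_smul, natCast_zsmul]
      abel
    rw [h2] at hν
    have h3 := hind _ ν hν
    have ha : a = a' := Fin.ext (by omega)
    subst ha
    have hw : w = w' := Subtype.ext (mul_left_cancel h0)
    rw [hw]
  simpa using Nat.card_le_card_of_injective f hf

end Congruence

/-! ### The matrix model over a ramified quadratic ring. -/

section Model

open Matrix

/-- The matrix `[[1, ϖ], [-ϖ, -2]]` of order three, where `ϖ² = 3`. -/
def matX {B : Type*} [CommRing B] {ϖ : B} (hϖ : ϖ ^ 2 = 3) : (Matrix (Fin 2) (Fin 2) B)ˣ where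
  val := !![1, ϖ; -ϖ, -2]
  inv := !![-2, -ϖ; ϖ, 1]
  val_inv := by
    ext i j
    fin_cases i <;> fin_cases j <;> simp [Matrix.mul_apply, Fin.sum_univ_two] <;>
      first | ring1 | linear_combination hϖ
  inv_val := by
    ext i j
    fin_cases i <;> fin_cases j <;> simp [Matrix.mul_apply, Fin.sum_univ_two] <;>
      first | ring1 | linear_combination hϖ

/-- The matrix `u [[1, ϖ], [ϖ, 1]]`, where `ϖ² = 3` and `2 u² = -1`. -/
def matY {B : Type*} [CommRing B] {ϖ u : B} (hϖ : ϖ ^ 2 = 3) (hu : 2 * u ^ 2 = -1) :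
    (Matrix (Fin 2) (Fin 2) B)ˣ where
  val := u • !![1, ϖ; ϖ, 1]
  inv := u • !![1, -ϖ; -ϖ, 1]
  val_inv := by
    ext i j
    fin_cases i <;> fin_cases j <;> simp [Matrix.mul_apply, Fin.sum_univ_two] <;>
      first | ring1 | linear_combination (-1 : B) * hu - u ^ 2 * hϖ
  inv_val := by
    ext i j
    fin_cases i <;> fin_cases j <;> simp [Matrix.mul_apply, Fin.sum_univ_two] <;>
      first | ring1 | linear_combination (-1 : B) * hu - u ^ 2 * hϖ

variable {B : Type*} [CommRing B] {ϖ u : B} (hϖ : ϖ ^ 2 = 3) (hu : 2 * u ^ 2 = -1)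

theorem matX_cube : matX hϖ ^ 3 = 1 := by
  have h : matX hϖ * matX hϖ = (matX hϖ)⁻¹ := by
    ext i j
    change (!![1, ϖ; -ϖ, -2] * !![1, ϖ; -ϖ, -2] : Matrix (Fin 2) (Fin 2) B) i j =
      (!![-2, -ϖ; ϖ, 1] : Matrix (Fin 2) (Fin 2) B) i j
    fin_cases i <;> fin_cases j <;> simp [Matrix.mul_apply, Fin.sum_univ_two] <;>
      first | ring1 | linear_combination (-1 : B) * hϖ
  rw [pow_succ, sq, h, inv_mul_cancel]

theorem matX_matY_rel : matY hϖ hu * matX hϖ * matY hϖ hu * (matX hϖ)⁻¹ * matY hϖ hu =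
    (matY hϖ hu)⁻¹ * (matX hϖ)⁻¹ * (matY hϖ hu)⁻¹ * matX hϖ * (matY hϖ hu)⁻¹ := by
  ext i j
  change ((u • !![1, ϖ; ϖ, 1]) * !![1, ϖ; -ϖ, -2] * (u • !![1, ϖ; ϖ, 1]) * !![-2, -ϖ; ϖ, 1] *
    (u • !![1, ϖ; ϖ, 1]) : Matrix (Fin 2) (Fin 2) B) i j =
    ((u • !![1, -ϖ; -ϖ, 1]) * !![-2, -ϖ; ϖ, 1] * (u • !![1, -ϖ; -ϖ, 1]) * !![1, ϖ; -ϖ, -2] *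
    (u • !![1, -ϖ; -ϖ, 1]) : Matrix (Fin 2) (Fin 2) B) i j
  have h3 : ϖ ^ 3 = 3 * ϖ := by linear_combination ϖ * hϖ
  have h5 : ϖ ^ 5 = 9 * ϖ := by linear_combination (ϖ ^ 3 + 3 * ϖ) * hϖ
  fin_cases i <;> fin_cases j <;>
    simp only [Matrix.mul_apply, Fin.sum_univ_two, Matrix.smul_apply, smul_eq_mul,
      Matrix.of_apply, Matrix.cons_val', Matrix.cons_val_zero, Matrix.cons_val_one,
      Matrix.cons_val_fin_one, Fin.zero_eta, Fin.mk_one, Fin.isValue] <;>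
    ring_nf <;> (try rw [h5]) <;> (try rw [h3]) <;> ring

theorem matX_leading : HasLeading ϖ 1 (matX hϖ) !![0, 1; -1, 0] := by
  refine ⟨!![0, 0; 0, -1], ?_⟩
  change !![1, ϖ; -ϖ, -2] = _
  ext i j
  fin_cases i <;> fin_cases j <;> simp
  linear_combination hϖ

theorem matY_leading {k : B} (hk : u = 1 + 3 * k) :
    HasLeading ϖ 1 (matY hϖ hu) !![0, 1; 1, 0] := by
  refine ⟨k • !![1, ϖ; ϖ, 1], ?_⟩
  change u • !![1, ϖ; ϖ, 1] = _
  ext i j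
  fin_cases i <;> fin_cases j <;> simp <;> rw [hk] <;>
    first | ring1 | linear_combination (-k) * hϖ | linear_combination (-k * ϖ) * hϖ

theorem leading_d {k : B} (hk : u = 1 + 3 * k) :
    HasLeading ϖ 2 (com (matY hϖ hu) (matX hϖ)) !![-2, 0; 0, 2] := by
  have h := (matY_leading hϖ hu hk).com le_rfl le_rfl (matX_leading hϖ)
  convert h using 1
  ext i j
  fin_cases i <;> fin_cases j <;> simp <;> norm_num

theorem leading_e {k : B} (hk : u = 1 + 3 * k) :
    HasLeading ϖ 3 (com (com (matY hϖ hu) (matX hϖ)) (matX hϖ)) !![0, -4; -4, 0] := by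
  have h := (leading_d hϖ hu hk).com (by omega) le_rfl (matX_leading hϖ)
  convert h using 1
  ext i j
  fin_cases i <;> fin_cases j <;> simp <;> norm_num

theorem leading_g {k : B} (hk : u = 1 + 3 * k) :
    HasLeading ϖ 3 (com (com (matY hϖ hu) (matX hϖ)) (matY hϖ hu)) !![0, -4; 4, 0] := by
  have h := (leading_d hϖ hu hk).com (by omega) le_rfl (matY_leading hϖ hu hk)
  convert h using 1
  ext i j
  fin_cases i <;> fin_cases j <;> simp <;> norm_num

/-- A lower bound for the order of a finite group mapping `x, y` to the matrices above. -/
theorem card_ge_of_hom {k : B} (hk : u = 1 + 3 * k) {A : Type*} [Group A] [Finite A]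
    (π : A →* (Matrix (Fin 2) (Fin 2) B)ˣ) {x y : A} (hx : π x = matX hϖ) (hy : π y = matY hϖ hu)
    (hA : ∀ a, π a ∈ congruenceSubgroup (Matrix (Fin 2) (Fin 2) B) ϖ 1) {n : ℕ}
    (hnd : ∀ i ≤ 2 * n + 1, ∀ (c : ℤ) (b : B), ϖ ^ i * c = ϖ ^ (i + 1) * b → 3 ∣ c) (m : ℕ)
    (hm : m ≤ n) : 9 * 27 ^ m * Nat.card
      ((congruenceSubgroup (Matrix (Fin 2) (Fin 2) B) ϖ (2 * m + 2)).comap π) ≤ Nat.card A := by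
  have hcom : ∀ a b : A, π (com a b) = com (π a) (π b) := fun a b => by simp [com]
  induction m with
  | zero =>
    have h1 : (congruenceSubgroup (Matrix (Fin 2) (Fin 2) B) ϖ 1).comap π = ⊤ :=
      eq_top_iff.2 fun a _ => hA a
    have := card_comap_congruenceSubgroup_pair π le_rfl (u := x) (v := y)
      (hx ▸ matX_leading hϖ) (hy ▸ matY_leading hϖ hu hk) ?_
    · rw [h1, Subgroup.card_top] at this
      simpa using this
    · intro a b ν hν
      -- The off-diagonal entries show that `3` divides `a + b` and `b - a`, hence both `a` and `b`.
      have h01 := hnd 1 (by omega) (a + b) (ν 0 1) (by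
        have := congrFun (congrFun hν 0) 1
        simp at this
        push_cast
        linear_combination this)
      have h10 := hnd 1 (by omega) (b - a) (ν 1 0) (by
        have := congrFun (congrFun hν 1) 0
        simp at this
        push_cast
        linear_combination this)
      omega
  | succ m ih =>
    have hd : HasLeading ϖ (2 * m + 2) (π (com y x ^ 3 ^ m)) !![-2, 0; 0, 2] := by
      rw [map_pow, hcom, hx, hy, add_comm]
      exact (leading_d hϖ hu hk).pow_three_pow hϖ le_rfl m
    have he : HasLeading ϖ (2 * m + 3) (π (com (com y x) x ^ 3 ^ m)) !![0, -4; -4, 0] := by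
      rw [map_pow, hcom, hcom, hx, hy, add_comm]
      exact (leading_e hϖ hu hk).pow_three_pow hϖ (by omega) m
    have hg : HasLeading ϖ (2 * m + 3) (π (com (com y x) y ^ 3 ^ m)) !![0, -4; 4, 0] := by
      rw [map_pow, hcom, hcom, hx, hy, add_comm]
      exact (leading_g hϖ hu hk).pow_three_pow hϖ (by omega) m
    have h1 := card_comap_congruenceSubgroup_single π (by omega) hd (by
      intro a ν hν
      have h11 := hnd (2 * m + 2) (by omega) (a * 2) (ν 1 1) (by
        have := congrFun (congrFun hν 1) 1
        simp at this
        push_cast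
        exact this)
      omega)
    have h2 := card_comap_congruenceSubgroup_pair π (by omega) he hg (by
      intro a b ν hν
      have h01 := hnd (2 * m + 3) (by omega) (-(a * 4) + -(b * 4)) (ν 0 1) (by
        have := congrFun (congrFun hν 0) 1
        simp at this
        push_cast
        exact this)
      have h10 := hnd (2 * m + 3) (by omega) (-(a * 4) + b * 4) (ν 1 0) (by
        have := congrFun (congrFun hν 1) 0
        simp at this
        push_cast
        exact this)
      omega)
    refine le_trans ?_ (ih (by omega))
    calc 9 * 27 ^ (m + 1) * Nat.card
          ((congruenceSubgroup (Matrix (Fin 2) (Fin 2) B) ϖ (2 * (m + 1) + 2)).comap π)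
        = 9 * 27 ^ m * (3 * (9 * Nat.card
          ((congruenceSubgroup (Matrix (Fin 2) (Fin 2) B) ϖ (2 * m + 3 + 1)).comap π))) := by
          ring_nf
      _ ≤ 9 * 27 ^ m * (3 * Nat.card
          ((congruenceSubgroup (Matrix (Fin 2) (Fin 2) B) ϖ (2 * m + 3)).comap π)) := by gcongr
      _ ≤ _ := by gcongr

theorem exists_two_mul_sq_eq_neg_one (m : ℕ) :
    ∃ a k : ℤ, a = 1 + 3 * k ∧ (3 : ℤ) ^ (m + 1) ∣ 2 * a ^ 2 + 1 := by
  induction m with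
  | zero => exact ⟨1, 0, by norm_num, by norm_num⟩
  | succ m ih =>
    obtain ⟨a, k, rfl, c, hc⟩ := ih
    -- Hensel lifting: the derivative `4a` is `1` modulo `3`, so a correction `s · 3^(m+1)` changes
    -- `c` to `c + s` modulo `3`, and `s = 2c` cancels it.
    refine ⟨1 + 3 * k + 3 ^ (m + 1) * (2 * c), k + 3 ^ m * (2 * c), by ring,
      c * (3 + 8 * k + 8 * 3 ^ m * c) , ?_⟩
    linear_combination hc

/-- The ramified quadratic extension `(ℤ/N)[√3]`. -/
abbrev SqrtThreeRing (N : ℕ) : Type := QuadraticAlgebra (ZMod N) 3 0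

theorem omega_sq (N : ℕ) : (QuadraticAlgebra.omega : SqrtThreeRing N) ^ 2 = 3 := by
  rw [sq]
  ext
  · simpa using (QuadraticAlgebra.re_ofNat 3).symm
  · simpa using (QuadraticAlgebra.im_ofNat 3).symm

theorem SqrtThreeRing.natCast_self (N : ℕ) : (N : SqrtThreeRing N) = 0 := by
  ext
  · simp
  · simp

theorem SqrtThreeRing.dvd_of_mul_omega {N : ℕ} {z : ℤ}
    (h : (z : SqrtThreeRing N) * QuadraticAlgebra.omega = 0) : (N : ℤ) ∣ z := by
  have := congrArg QuadraticAlgebra.im h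
  rw [← ZMod.intCast_zmod_eq_zero_iff_dvd]
  simpa using this

theorem exists_coefficients (n : ℕ) : ∃ (B : Type) (_ : CommRing B) (_ : Finite B) (ϖ u k : B),
    ϖ ^ 2 = 3 ∧ 2 * u ^ 2 = -1 ∧ u = 1 + 3 * k ∧ ϖ ^ (2 * n + 2) = 0 ∧
      ∀ i ≤ 2 * n + 1, ∀ (c : ℤ) (b : B), ϖ ^ i * c = ϖ ^ (i + 1) * b → 3 ∣ c := by
  obtain ⟨a, k, hak, hdvd⟩ := exists_two_mul_sq_eq_neg_one n
  have h3 : (3 : SqrtThreeRing (3 ^ (n + 1))) ^ (n + 1) = 0 := by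
    have h := SqrtThreeRing.natCast_self (3 ^ (n + 1))
    rw [Nat.cast_pow] at h
    exact h
  have hdim := fun z => SqrtThreeRing.dvd_of_mul_omega (N := 3 ^ (n + 1)) (z := z)
  have hN : 0 < 3 ^ (n + 1) := by positivity
  have hcast : ((3 ^ (n + 1) : ℕ) : ℤ) = 3 ^ (n + 1) := by push_cast; rfl
  rw [hcast] at hdim
  clear hcast
  generalize 3 ^ (n + 1) = N at h3 hdim hN
  have : NeZero N := ⟨hN.ne'⟩
  have hω := omega_sq N
  have hfin : Finite (SqrtThreeRing N) := Finite.of_equiv _ (QuadraticAlgebra.equivProd _ _).symm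
  have hω0 : (QuadraticAlgebra.omega : SqrtThreeRing N) ^ (2 * n + 2) = 0 := by
    rw [show 2 * n + 2 = 2 * (n + 1) by ring, pow_mul, hω, h3]
  refine ⟨SqrtThreeRing N, inferInstance, hfin,
    QuadraticAlgebra.omega, (a : SqrtThreeRing N), (k : SqrtThreeRing N), hω, ?_, ?_, hω0, ?_⟩
  · obtain ⟨c, hc⟩ := hdvd
    have h := congrArg (Int.cast : ℤ → SqrtThreeRing N) hc
    rw [Int.cast_mul, Int.cast_pow, Int.cast_ofNat, h3, zero_mul, Int.cast_add, Int.cast_mul,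
      Int.cast_pow, Int.cast_one, Int.cast_ofNat] at h
    exact eq_neg_of_add_eq_zero_left h
  · rw [hak, Int.cast_add, Int.cast_mul, Int.cast_one, Int.cast_ofNat]
  · intro i hi c b hcb
    -- Multiplying up to the last nonzero degree `2n + 1` annihilates the right side and leaves `3ⁿ
    -- c ϖ = 0`, so `3^(n+1)` divides `3ⁿ c`.
    have h1 := congrArg (fun t => QuadraticAlgebra.omega ^ (2 * n + 1 - i) * t) hcb
    simp only [← mul_assoc, ← pow_add] at h1
    rw [show 2 * n + 1 - i + i = 2 * n + 1 by omega,
      show 2 * n + 1 - i + (i + 1) = 2 * n + 2 by omega, hω0, zero_mul, pow_succ, pow_mul, hω] at h1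
    have h4 : ((3 ^ n * c : ℤ) : SqrtThreeRing N) * QuadraticAlgebra.omega = 0 := by
      rw [Int.cast_mul, Int.cast_pow, Int.cast_ofNat, mul_right_comm]
      exact h1
    have h2 := hdim _ h4
    rw [pow_succ] at h2
    exact (mul_dvd_mul_iff_left (by positivity)).1 h2

end Model

/-! ### A finite quotient of the full order. -/

section LowerBound

open FreePro3

/-- The word `x³ y^(-3ⁿ)` in the abstract free group. -/
def wordR (n : ℕ) : FreeGroup (Fin 2) :=
  FreeGroup.of 0 ^ 3 * FreeGroup.of 1 ^ (-(3 : ℤ) ^ n)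

/-- The word `y x y x⁻¹ y` in the abstract free group. -/
def wordT : FreeGroup (Fin 2) :=
  FreeGroup.of 1 * FreeGroup.of 0 * FreeGroup.of 1 * (FreeGroup.of 0)⁻¹ * FreeGroup.of 1

/-- The abstract relators of `GroupG n`. -/
def relators (n : ℕ) : Set (FreeGroup (Fin 2)) :=
  {(wordR n)⁻¹ * invGens (wordR n), wordT⁻¹ * invGens wordT}

theorem map_invGens_wordR {A : Type*} [Group A] (f : FreeGroup (Fin 2) →* A) (n : ℕ) :
    f ((wordR n)⁻¹ * invGens (wordR n)) =
      (f (.of 0) ^ 3 * f (.of 1) ^ (-(3 : ℤ) ^ n))⁻¹ *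
        ((f (.of 0))⁻¹ ^ 3 * (f (.of 1))⁻¹ ^ (-(3 : ℤ) ^ n)) := by
  simp [wordR, invGens]

theorem map_invGens_wordT {A : Type*} [Group A] (f : FreeGroup (Fin 2) →* A) :
    f (wordT⁻¹ * invGens wordT) =
      (f (.of 1) * f (.of 0) * f (.of 1) * (f (.of 0))⁻¹ * f (.of 1))⁻¹ *
        ((f (.of 1))⁻¹ * (f (.of 0))⁻¹ * (f (.of 1))⁻¹ * f (.of 0) * (f (.of 1))⁻¹) := by
  simp [wordT, invGens, mul_assoc]

theorem closure_map_of {A : Type*} [Group A] (f : FreeGroup (Fin 2) →* A)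
    (hf : Function.Surjective f) : Subgroup.closure {f (.of 0), f (.of 1)} = ⊤ := by
  have h := FreeGroup.closure_range_of (Fin 2)
  have h1 := congrArg (Subgroup.map f) h
  rw [MonoidHom.map_closure, ← Set.range_comp, Subgroup.map_top_of_surjective f hf] at h1
  rw [← h1]
  congr 1
  ext a
  simp [Fin.exists_fin_two, eq_comm]

theorem exists_large_pNormal (n : ℕ) : ∃ L : PNormal 3 (FreeGroup (Fin 2)),
    relators n ⊆ L.sub ∧ 3 ^ (3 * n + 2) ≤ L.sub.index := by
  obtain ⟨B, _, _, ϖ, u, k, hϖ, hu, hk, hϖ0, hnd⟩ := exists_coefficients n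
  let E := Matrix (Fin 2) (Fin 2) B
  let X : Eˣ := matX hϖ
  let Y : Eˣ := matY hϖ hu
  have hX1 : X ∈ congruenceSubgroup E ϖ 1 := (matX_leading hϖ).mem
  have hY1 : Y ∈ congruenceSubgroup E ϖ 1 := (matY_leading hϖ hu hk).mem
  -- As `X³ = 1`, the element `ζ` of order `9` gives the first generator a nontrivial central cube,
  -- to be identified with `Y^(3ⁿ)`.
  let ζ : Multiplicative (ZMod 9) := Multiplicative.ofAdd 1
  have hζ : ∀ c : Multiplicative (ZMod 9), c ^ 9 = 1 := by decide
  have hζ3 : ζ ^ 3 ≠ 1 := by decide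
  let f : FreeGroup (Fin 2) →* Eˣ × Multiplicative (ZMod 9) :=
    FreeGroup.lift ![(X, ζ), (Y, 1)]
  have hf0 : f (.of 0) = (X, ζ) := FreeGroup.lift_apply_of
  have hf1 : f (.of 1) = (Y, 1) := FreeGroup.lift_apply_of
  have hmem : ∀ w, (f w).1 ∈ congruenceSubgroup E ϖ 1 := by
    intro w
    induction w using FreeGroup.induction_on with
    | C1 => simp
    | of i => fin_cases i <;> simpa [f]
    | inv_of i h => rw [map_inv]; exact inv_mem h
    | mul a b ha hb => rw [map_mul]; exact mul_mem ha hb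
  have hX3 : X ^ 3 = 1 := matX_cube hϖ
  -- The image of `r_n`. It is central of order dividing `3`, and `σ(r_n)` maps to `z⁻¹`, so
  -- dividing by `⟨z⟩` imposes the first relator at the cost of a factor at most `3`.
  let z : Eˣ × Multiplicative (ZMod 9) := ((Y ^ 3 ^ n)⁻¹, ζ ^ 3)
  have hYX : Y ^ 3 ^ n * X = X * Y ^ 3 ^ n := by
    rw [mul_com (Y ^ 3 ^ n) X]
    have h1 := com_mem_congruenceSubgroup (pow_mem_congruenceSubgroup hϖ hY1 n) hX1
    rw [eq_one_of_mem_congruenceSubgroup (i := 2 * n + 2) hϖ0 h1, mul_one]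
  have hzc : ∀ w, Commute (f w) z := by
    intro w
    induction w using FreeGroup.induction_on with
    | C1 => simp
    | of i =>
      fin_cases i
      · change Commute (f (.of 0)) z
        rw [hf0]
        exact Commute.prod (show Commute X (Y ^ 3 ^ n)⁻¹ from
          (show Commute X (Y ^ 3 ^ n) from hYX.symm).inv_right) (mul_comm _ _)
      · change Commute (f (.of 1)) z
        rw [hf1]
        exact Commute.prod (show Commute Y (Y ^ 3 ^ n)⁻¹ from
          ((Commute.refl Y).pow_right _).inv_right) (mul_comm _ _)
    | inv_of i h => rw [map_inv]; exact h.inv_left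
    | mul a b ha hb => rw [map_mul]; exact ha.mul_left hb
  have hz3 : z ^ 3 = 1 := by
    have h1 := pow_mem_congruenceSubgroup hϖ hY1 (n + 1)
    have h2 := eq_one_of_mem_congruenceSubgroup hϖ0
      (congruenceSubgroup_anti (i := 2 * n + 2) (by omega) h1)
    refine Prod.ext ?_ (by change (ζ ^ 3) ^ 3 = 1; rw [← pow_mul]; exact hζ ζ)
    change ((Y ^ 3 ^ n)⁻¹) ^ 3 = 1
    rw [inv_pow, ← pow_mul, ← pow_succ, h2, inv_one]
  let L : Subgroup (FreeGroup (Fin 2)) := (Subgroup.zpowers z).comap f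
  have hLn : L.Normal := by
    refine ⟨fun w hw g => ?_⟩
    obtain ⟨m, hm⟩ := Subgroup.mem_zpowers_iff.1 (Subgroup.mem_comap.1 hw)
    rw [Subgroup.mem_comap, map_mul, map_mul, map_inv, ← hm, ((hzc g).zpow_right m).eq,
      mul_inv_cancel_right]
    exact Subgroup.zpow_mem_zpowers z m
  have hker : f.ker ≤ L := fun w hw => by
    rw [Subgroup.mem_comap, MonoidHom.mem_ker.1 hw]; exact one_mem _
  have hkerfin : f.ker.index ≠ 0 := by
    rw [Subgroup.index_ker]
    exact Nat.card_pos.ne'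
  have hexp : ∀ w, w ^ 3 ^ (n + 2) ∈ f.ker := by
    intro w
    rw [MonoidHom.mem_ker, map_pow]
    refine Prod.ext ?_ ?_
    · have h1 := pow_mem_congruenceSubgroup hϖ (hmem w) (n + 2)
      exact eq_one_of_mem_congruenceSubgroup hϖ0
        (congruenceSubgroup_anti (i := 2 * n + 2) (by omega) h1)
    · change (f w).2 ^ 3 ^ (n + 2) = 1
      rw [add_comm, pow_add, pow_mul]
      exact (congrArg (· ^ 3 ^ n) (hζ _)).trans (one_pow _)
  have hLfin : L.index ≠ 0 := fun h0 => hkerfin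
    (Nat.eq_zero_of_zero_dvd (h0 ▸ Subgroup.index_dvd_of_le hker))
  have hLp : IsPGroup 3 (FreeGroup (Fin 2) ⧸ L) := by
    intro q
    induction q using QuotientGroup.induction_on with
    | H w => exact ⟨n + 2, (QuotientGroup.eq_one_iff _).2 (hker (hexp w))⟩
  have hfinQ : Finite (FreeGroup (Fin 2) ⧸ L) := Nat.finite_of_card_ne_zero hLfin
  obtain ⟨e, he⟩ := IsPGroup.iff_card.1 hLp
  refine ⟨⟨L, hLn, e, he⟩, ?_, ?_⟩
  · rintro _ (rfl | rfl)
    · change f _ ∈ Subgroup.zpowers z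
      rw [map_invGens_wordR, hf0, hf1]
      have e1 : (X, ζ) ^ 3 * ((Y, 1) : Eˣ × Multiplicative (ZMod 9)) ^ (-(3 : ℤ) ^ n) = z := by
        refine Prod.ext ?_ ?_
        · change X ^ 3 * Y ^ (-(3 : ℤ) ^ n) = (Y ^ 3 ^ n)⁻¹
          rw [hX3, one_mul, zpow_neg, ← zpow_natCast]
          norm_cast
        · change ζ ^ 3 * 1 ^ (-(3 : ℤ) ^ n) = ζ ^ 3
          rw [one_zpow, mul_one]
      have e2 : (X, ζ)⁻¹ ^ 3 * ((Y, 1) : Eˣ × Multiplicative (ZMod 9))⁻¹ ^ (-(3 : ℤ) ^ n) =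
          z⁻¹ := by
        refine Prod.ext ?_ ?_
        · change X⁻¹ ^ 3 * Y⁻¹ ^ (-(3 : ℤ) ^ n) = (Y ^ 3 ^ n)⁻¹⁻¹
          rw [inv_pow, hX3, inv_one, one_mul, inv_zpow, zpow_neg, ← zpow_natCast]
          norm_cast
        · change ζ⁻¹ ^ 3 * 1⁻¹ ^ (-(3 : ℤ) ^ n) = (ζ ^ 3)⁻¹
          rw [inv_one, one_zpow, mul_one, inv_pow]
      rw [e1, e2]
      exact mul_mem (inv_mem (Subgroup.mem_zpowers z)) (inv_mem (Subgroup.mem_zpowers z))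
    · change f _ ∈ Subgroup.zpowers z
      rw [map_invGens_wordT, hf0, hf1]
      refine (Subgroup.zpowers z).mem_carrier.1 ?_
      rw [inv_mul_eq_one.2 ?_]
      · exact one_mem (Subgroup.zpowers z)
      refine Prod.ext (matX_matY_rel hϖ hu) ?_
      change 1 * ζ * 1 * ζ⁻¹ * 1 = 1⁻¹ * ζ⁻¹ * 1⁻¹ * ζ * 1⁻¹
      simp
  · change 3 ^ (3 * n + 2) ≤ L.index
    let π : f.range →* Eˣ := (MonoidHom.fst _ _).comp f.range.subtype
    have hcard := card_ge_of_hom hϖ hu hk π (x := ⟨f (.of 0), ⟨_, rfl⟩⟩)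
      (y := ⟨f (.of 1), ⟨_, rfl⟩⟩) (congrArg Prod.fst hf0) (congrArg Prod.fst hf1)
      (by rintro ⟨_, w, rfl⟩; exact hmem w) hnd n le_rfl
    -- The image of `x³` is `(1, ζ³)`, invisible to the matrices; this factor `3` compensates for
    -- the quotient by `⟨z⟩`.
    have hkerpi : 3 ≤ Nat.card ((congruenceSubgroup E ϖ (2 * n + 2)).comap π) := by
      let c : f.range := ⟨f (.of 0 ^ 3), ⟨_, rfl⟩⟩
      have hc : (c : Eˣ × Multiplicative (ZMod 9)) = (1, ζ ^ 3) := by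
        change f (.of 0 ^ 3) = _
        rw [map_pow, hf0]
        exact Prod.ext hX3 rfl
      have hcm : c ∈ (congruenceSubgroup E ϖ (2 * n + 2)).comap π := by
        change (c : Eˣ × Multiplicative (ZMod 9)).1 ∈ congruenceSubgroup E ϖ (2 * n + 2)
        rw [hc]; exact one_mem _
      have hord : orderOf c = 3 := by
        refine orderOf_eq_prime (Subtype.ext ?_) fun h => hζ3 ?_
        · change (c : Eˣ × Multiplicative (ZMod 9)) ^ 3 = 1
          rw [hc]
          refine Prod.ext (one_pow 3) ?_
          change (ζ ^ 3) ^ 3 = 1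
          rw [← pow_mul]; exact hζ ζ
        · have := congrArg (fun a : f.range => (a : Eˣ × Multiplicative (ZMod 9)).2) h
          simp only [hc] at this
          exact this
      rw [← hord, ← Nat.card_zpowers]
      exact Subgroup.card_le_of_le ((Subgroup.zpowers_le).2 hcm)
    have hrel : f.ker.relIndex L ≤ 3 := by
      rw [Subgroup.relIndex_ker]
      have h1 : (L.map f : Subgroup _) ≤ Subgroup.zpowers z := Subgroup.map_comap_le _ _
      have h2 := Subgroup.card_le_of_le h1
      rw [Nat.card_zpowers] at h2
      exact h2.trans (orderOf_le_of_pow_eq_one (by norm_num) hz3)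
    have hmul := Subgroup.relIndex_mul_index hker
    rw [Subgroup.index_ker] at hmul
    have h5 : 9 * 27 ^ n * 3 ≤ 3 * L.index := by
      calc 9 * 27 ^ n * 3 ≤ 9 * 27 ^ n *
            Nat.card ((congruenceSubgroup E ϖ (2 * n + 2)).comap π) := by gcongr
        _ ≤ Nat.card f.range := hcard
        _ = f.ker.relIndex L * L.index := hmul.symm
        _ ≤ 3 * L.index := by gcongr
    rw [pow_add, pow_mul]
    norm_num
    omega

end LowerBound

/-! ### From finite quotients to the pro-`3` presentation. -/

section ProfinitePresentation

open FreePro3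

theorem schurRel_of_relators {A : Type*} [Group A] [Finite A] (hA : IsPGroup 3 A)
    (f : FreeGroup (Fin 2) →* A) (hf : Function.Surjective f) {n : ℕ} (hn : 1 ≤ n)
    (hrel : relators n ⊆ f.ker) :
    SchurRel (f (.of 0)) (f (.of 1)) ∧ f (.of 0) ^ 3 = f (.of 1) ^ 3 ^ n := by
  refine hA.schurRel (closure_map_of f hf) hn ?_ ?_
  · rw [← map_invGens_wordR]
    exact hrel (Or.inl rfl)
  · rw [← map_invGens_wordT]
    exact hrel (Or.inr rfl)

namespace PNormal

variable {p : ℕ} [Fact p.Prime] {G : Type} [Group G]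

/-- A normal subgroup whose index divides a power of `p`. -/
def ofDvd (N : Subgroup G) [hN : N.Normal] {k : ℕ} (h : N.index ∣ p ^ k) : PNormal p G :=
  ⟨N, hN, by
    obtain ⟨j, -, hj⟩ := (Nat.dvd_prime_pow Fact.out).1 h
    exact ⟨j, hj⟩⟩

theorem exists_inf (N M : PNormal p G) : ∃ K : PNormal p G, K.sub = N.sub ⊓ M.sub := by
  obtain ⟨k, hk⟩ := N.index_eq
  obtain ⟨l, hl⟩ := M.index_eq
  have h : (N.sub ⊓ M.sub).index ∣ p ^ (l + k) := by
    rw [← Subgroup.relIndex_mul_index (inf_le_left : N.sub ⊓ M.sub ≤ N.sub),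
      Subgroup.inf_relIndex_left, pow_add, ← hk, ← hl]
    exact Nat.mul_dvd_mul (Subgroup.relIndex_dvd_index_of_normal _ _) dvd_rfl
  exact ⟨ofDvd _ h, rfl⟩

theorem exists_le (I : Finset (PNormal p G)) : ∃ K : PNormal p G, ∀ N ∈ I, K.sub ≤ N.sub := by
  classical
  induction I using Finset.induction_on with
  | empty => exact ⟨ofDvd (k := 0) ⊤ (by simp), by simp⟩
  | insert N I _ ih =>
    obtain ⟨K, hK⟩ := ih
    obtain ⟨J, hJ⟩ := exists_inf N K
    refine ⟨J, fun M hM => ?_⟩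
    rw [hJ]
    rcases Finset.mem_insert.1 hM with rfl | hM
    · exact inf_le_left
    · exact inf_le_right.trans (hK M hM)

theorem finite_quot (N : PNormal p G) : Finite N.Quot := by
  obtain ⟨k, hk⟩ := N.index_eq
  exact Nat.finite_of_card_ne_zero
    (show N.sub.index ≠ 0 by rw [hk]; exact (pow_pos (Fact.out : p.Prime).pos k).ne')

omit [Fact p.Prime] in
theorem isPGroup_quot (N : PNormal p G) : IsPGroup p N.Quot := by
  obtain ⟨k, hk⟩ := N.index_eq
  exact IsPGroup.of_card hk

end PNormal

namespace proPCompletion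

variable {p : ℕ} {G : Type} [Group G]

/-- The projection of the pro-`p` completion to a finite quotient. -/
def eval (N : PNormal p G) : proPCompletion p G →* N.Quot :=
  (Pi.evalMonoidHom (fun N : PNormal p G => N.Quot) N).comp (proPCompletion p G).subtype

theorem eval_of (N : PNormal p G) (g : G) : eval N (of p g) = QuotientGroup.mk g := rfl

theorem proj_eval (N M : PNormal p G) (h : N.sub ≤ M.sub) (f : proPCompletion p G) :
    N.proj M h (eval N f) = eval M f := f.2 N M h

theorem eval_surjective (N : PNormal p G) : Function.Surjective (eval N) := fun q => by
  induction q using QuotientGroup.induction_on with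
  | H g => exact ⟨of p g, rfl⟩

theorem continuous_eval (N : PNormal p G) : Continuous (eval N) :=
  (continuous_apply N).comp continuous_subtype_val

/-- A basic open set restricts finitely many coordinates, and all of these are determined by one
finer quotient. -/
theorem mem_closure_of_forall_eval [Fact p.Prime] {C : Set (proPCompletion p G)}
    {f : proPCompletion p G} (h : ∀ M : PNormal p G, ∃ g ∈ C, eval M g = eval M f) :
    f ∈ closure C := by
  rw [mem_closure_iff]
  intro U hU hfU
  obtain ⟨V, hV, rfl⟩ := isOpen_induced_iff.1 hU
  obtain ⟨I, u, hu, huV⟩ := isOpen_pi_iff.1 hV f.1 hfU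
  obtain ⟨M, hM⟩ := PNormal.exists_le I
  obtain ⟨g, hgC, hg⟩ := h M
  refine ⟨g, huV fun N hN => ?_, hgC⟩
  have h1 : eval N g = eval N f := by
    rw [← proj_eval M N (hM N hN), hg, proj_eval]
  have h2 : g.1 N = f.1 N := h1
  rw [h2]
  exact (hu N hN).2

/-- If a quotient by a normal subgroup containing `R` is maximal among the finite `p`-quotients
killing `R`, then its kernel is the closed normal closure of `R`. -/
theorem closedNormalClosure_eq_ker [Fact p.Prime] (R : Set G) (L : PNormal p G)
    (hR : R ⊆ L.sub)
    (hmax : ∀ M : PNormal p G, R ⊆ M.sub → M.sub.index ≤ L.sub.index) :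
    closedNormalClosure (of p '' R) = (eval L).ker := by
  apply le_antisymm
  · refine Subgroup.topologicalClosure_minimal _ (Subgroup.normalClosure_le_normal ?_) ?_
    · rintro _ ⟨g, hg, rfl⟩
      exact (QuotientGroup.eq_one_iff g).2 (hR hg)
    · exact IsClosed.preimage (continuous_eval L) (isClosed_discrete {1})
  · intro f hf
    refine mem_closure_of_forall_eval fun M => ?_
    obtain ⟨M₂, hM₂⟩ := PNormal.exists_inf M L
    have hle : M₂.sub ≤ M.sub := hM₂ ▸ inf_le_left
    have hle' : M₂.sub ≤ L.sub := hM₂ ▸ inf_le_right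
    obtain ⟨γ, hγ⟩ := QuotientGroup.mk_surjective (eval M₂ f)
    have hγL : γ ∈ L.sub := by
      rw [← QuotientGroup.eq_one_iff]
      have h1 := proj_eval M₂ L hle' f
      rw [← hγ, MonoidHom.mem_ker.1 hf] at h1
      exact h1
    have hMγ : eval M f = QuotientGroup.mk γ := by
      rw [← proj_eval M₂ M hle f, ← hγ]
      rfl
    obtain ⟨k, hk⟩ := M.index_eq
    -- `J ⊓ L` still contains `R`, so maximality of the index makes it equal to `L`. Hence `γ` lies
    -- in `M · normalClosure R`, and its second factor agrees with `f` in the quotient by `M`.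
    let J : PNormal p G := PNormal.ofDvd (p := p) (M.sub ⊔ Subgroup.normalClosure R) (k := k)
      (hk ▸ Subgroup.index_dvd_of_le le_sup_left)
    obtain ⟨P, hP⟩ := PNormal.exists_inf J L
    have hPL : P.sub ≤ L.sub := hP ▸ inf_le_right
    have hRP : R ⊆ P.sub := fun g hg => by
      rw [hP]
      exact ⟨SetLike.le_def.1 (le_sup_right (a := M.sub)) (Subgroup.subset_normalClosure hg),
        hR hg⟩
    have hLJ : L.sub ≤ P.sub := by
      rw [← Subgroup.relIndex_eq_one]
      have h1 := Subgroup.relIndex_mul_index hPL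
      have h2 := hmax P hRP
      have hpos : ∀ N : PNormal p G, 0 < N.sub.index := fun N => by
        obtain ⟨j, hj⟩ := N.index_eq
        rw [hj]
        exact pow_pos (Fact.out : p.Prime).pos j
      have h3 := hpos P
      have h4 := hpos L
      have h5 : 0 < P.sub.relIndex L.sub := Nat.pos_of_ne_zero fun h0 => by
        rw [h0, zero_mul] at h1
        omega
      nlinarith
    have hγJ : γ ∈ M.sub ⊔ Subgroup.normalClosure R := by
      have := hLJ hγL
      rw [hP] at this
      exact this.1
    rw [Subgroup.mem_sup_of_normal_left] at hγJ
    obtain ⟨m, hm, ν, hν, rfl⟩ := hγJ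
    refine ⟨of p ν, ?_, ?_⟩
    · have : Subgroup.normalClosure R ≤ (Subgroup.normalClosure (of p '' R)).comap (of p) :=
        Subgroup.normalClosure_le_normal fun g hg =>
          Subgroup.subset_normalClosure ⟨g, hg, rfl⟩
      exact this hν
    · rw [hMγ, eval_of, QuotientGroup.mk_mul, (QuotientGroup.eq_one_iff m).2 hm, one_mul]

end proPCompletion

theorem image_relators (n : ℕ) :
    proPCompletion.of 3 '' relators n = {(r n)⁻¹ * σ (r n), t⁻¹ * σ t} := by
  have hr : r n = proPCompletion.of 3 (wordR n) := by
    rw [wordR, map_mul, map_pow, map_zpow]; rfl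
  have ht : t = proPCompletion.of 3 wordT := by
    rw [wordT, map_mul, map_mul, map_mul, map_mul, map_inv]; rfl
  have hσ : ∀ w, σ (proPCompletion.of 3 w) = proPCompletion.of 3 (invGens w) := fun w =>
    proPCompletion.map_of invGens w
  rw [relators, Set.image_pair, hr, ht, hσ, hσ, map_mul, map_mul, map_inv, map_inv]

theorem index_le_of_relators {n : ℕ} (hn : 1 ≤ n) (M : PNormal 3 (FreeGroup (Fin 2)))
    (hM : relators n ⊆ M.sub) : M.sub.index ≤ 3 ^ (3 * n + 2) := by
  have := M.finite_quot
  have hp := M.isPGroup_quot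
  have := hp.isNilpotent
  obtain ⟨h, hpow⟩ := schurRel_of_relators hp (QuotientGroup.mk' M.sub)
    (QuotientGroup.mk'_surjective _) hn (by rwa [QuotientGroup.ker_mk'])
  exact h.card_le_of_lcs_eq_bot (h.lcs_eq_bot hn hpow)

/-- The large quotient attains the upper bound, so it is maximal and its kernel is the closed normal
closure of the relators. -/
theorem exists_hom_groupG {n : ℕ} (hn : 1 ≤ n) : Nat.card (GroupG n) = 3 ^ (3 * n + 2) ∧
    ∃ f : FreeGroup (Fin 2) →* GroupG n, Function.Surjective f ∧ relators n ⊆ f.ker := by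
  obtain ⟨L, hL, hcard⟩ := exists_large_pNormal n
  have hcard' : L.sub.index = 3 ^ (3 * n + 2) := le_antisymm (index_le_of_relators hn L hL) hcard
  have hker : closedNormalClosure {(r n)⁻¹ * σ (r n), t⁻¹ * σ t} =
      (proPCompletion.eval L).ker := by
    rw [← image_relators]
    exact proPCompletion.closedNormalClosure_eq_ker _ L hL fun M hM =>
      (index_le_of_relators hn M hM).trans hcard
  let e : GroupG n ≃* L.Quot := (QuotientGroup.quotientMulEquivOfEq hker).trans
    (QuotientGroup.quotientKerEquivOfSurjective _ (proPCompletion.eval_surjective L))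
  refine ⟨(Nat.card_congr e.toEquiv).trans hcard',
    e.symm.toMonoidHom.comp (QuotientGroup.mk' L.sub),
    e.symm.surjective.comp (QuotientGroup.mk'_surjective _), fun w hw => ?_⟩
  have h1 : QuotientGroup.mk' L.sub w = 1 := (QuotientGroup.eq_one_iff w).2 (hL hw)
  change e.symm (QuotientGroup.mk' L.sub w) = 1
  rw [h1, map_one]

end ProfinitePresentation

theorem floor_logb_eq (n : ℕ) : ⌊Real.logb 2 (3 * (n : ℝ) + 3)⌋₊ = Nat.log 2 (3 * n + 3) := by
  have h := Real.natFloor_logb_natCast 2 (3 * n + 3)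
  push_cast at h
  exact h

theorem theorem1 :
    (∀ n : ℕ, 1 ≤ n →
      (Finite (GroupG n) ∧ IsPGroup 3 (GroupG n) ∧ Nat.card (GroupG n) = 3 ^ (3 * n + 2)) ∧
      (Group.IsNilpotent (GroupG n) ∧ Group.nilpotencyClass (GroupG n) = 2 * n + 1) ∧
      HasDerivedLength (GroupG n) ⌊Real.logb 2 (3 * (n : ℝ) + 3)⌋₊) ∧
    (∀ m : ℕ, ∃ n : ℕ, 1 ≤ n ∧ ∃ d : ℕ, HasDerivedLength (GroupG n) d ∧ m < d) := by
  have main : ∀ n : ℕ, 1 ≤ n →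
      (Finite (GroupG n) ∧ IsPGroup 3 (GroupG n) ∧ Nat.card (GroupG n) = 3 ^ (3 * n + 2)) ∧
      (Group.IsNilpotent (GroupG n) ∧ Group.nilpotencyClass (GroupG n) = 2 * n + 1) ∧
      HasDerivedLength (GroupG n) ⌊Real.logb 2 (3 * (n : ℝ) + 3)⌋₊ := by
    intro n hn
    obtain ⟨hcard, f, hf, hrel⟩ := exists_hom_groupG hn
    have hfin : Finite (GroupG n) :=
      Nat.finite_of_card_ne_zero (by rw [hcard]; positivity)
    have hp : IsPGroup 3 (GroupG n) := IsPGroup.of_card hcard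
    have hnil : Group.IsNilpotent (GroupG n) := hp.isNilpotent
    obtain ⟨h, hpow⟩ := schurRel_of_relators hp f hf hn hrel
    rw [floor_logb_eq]
    exact ⟨⟨hfin, hp, hcard⟩, ⟨hnil, h.nilpotencyClass_eq hn hpow hcard⟩,
      h.hasDerivedLength hn hpow hcard⟩
  refine ⟨main, fun m => ?_⟩
  -- For `n = 2^(m+1)` the binary logarithm of `3n + 3` is at least `m + 1`.
  have hn : 1 ≤ 2 ^ (m + 1) := Nat.one_le_two_pow
  refine ⟨2 ^ (m + 1), hn, _, (main _ hn).2.2, ?_⟩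
  rw [floor_logb_eq]
  have : m + 1 ≤ Nat.log 2 (3 * 2 ^ (m + 1) + 3) :=
    Nat.le_log_of_pow_le (by norm_num) (by omega)
  omega
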